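/- Let $d\ge 1$ be fixed, let $n\ge 1$, and consider a consistent system of linear equations over $\mathrm{GF}(2)$ in $x_1,\dots,x_n$ in reduced row echelon form, with equations $x_i\oplus f_i=0$ for $1\le i\le r\le n$, where $f_i=\bigl(\bigoplus_{j\in \mathrm{Supp}_i}x_j\bigr)\oplus\alpha_i$, $\mathrm{Supp}_i\subseteq\{r+1,\dots,n\}$ and $\alpha_i\in\{0,1\}$. Put $f_i:=x_i$ for $i>r$. Let $$G_1=\{x_i-M(f_i): 1\le i\le r\}\cup\{x_j^2-x_j : r<j\le n\}\subset\mathbb R[x_1,\dots,x_n],$$ where $$M(f_i)=\sum_{k=1}^{|\mathrm{Supp}_i|}(-1)^{k-1}2^{k-1}\sum_{T\subseteq \mathrm{Supp}_i,\,|T|=k}\ \prod_{j\in T}x_j$$ if $\alpha_i=0$, and $M(f_i)$ is $1$ minus this sum if $\alpha_i=1$. Write $q|_{G_1}$ for the normal form of $q$ modulo $G_1$. The conversion algorithm takes $d$ and $G_1$, the latter given by the Boolean functions $f_1,\dots,f_n$, and works with the monomial orders in which $x_1>\dots>x_n$. It forms the list $Q$ of all monomials of degree at least $1$ and at most $d$,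 and starts with $G_2=\emptyset$, $B=\{b_1\}$ with $b_1=1$, and $C=\{c_1\}$ with $c_1=1$. While $Q\neq\emptyset$, it takes the grlex-smallest $q=x_{i_1}\cdots x_{i_m}\in Q$ and expands, as a function on the solutions of the system, $$q|_{G_1}=f_{i_1}\cdots f_{i_m}=\frac1{2^{m-1}}\sum_{\emptyset\ne T\subseteq[m]}(-1)^{|T|-1}\bigoplus_{t\in T}f_{i_t}$$ into Boolean terms, the longest of which is $F=f_{i_1}\oplus\cdots\oplus f_{i_m}$. A Boolean term $f$ appears in $c_l\in C$ if the longest Boolean term $F_l$ of $c_l$ is $f$ or $f\oplus 1$. In that case $f$ can be replaced by a linear combination of $b_1|_{G_1},\dots,b_l|_{G_1}$, since $c_l=b_l|_{G_1}$ is stored as a linear combination of $F_l$ and the $b_j|_{G_1}$ with $j<l$, and $F_l\oplus1=1-F_l$. All Boolean terms of $q|_{G_1}$ other than $F$ are replaced in this way. * If $F$ does not appear in any element of $C$, then $q$ is appended to $B$, the resulting linear combination of $F$ and the $b_j|_{G_1}$ is added to $C$, and $q$ is deleted from $Q$. * If $F$ appears in some element of $C$, then $F$ is replaced as well, which gives $q|_{G_1}=\sum_j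 k_j\, b_j|_{G_1}$. The polynomial $q-\sum_j k_jb_j$ is added to $G_2$, and $q$ and all its multiples are deleted from $Q$. The algorithm outputs $G_2$ once $Q$ is empty. **Theorem.** For every such input the algorithm terminates, and its output is the $d$-truncated reduced Gröbner basis of the ideal $\langle G_1\rangle$ with respect to the grlex order, that is, the set of all elements of degree at most $d$ of the reduced grlex Gröbner basis of $\langle G_1\rangle$. Its running time is $O(n^{2d})$: there is a constant $K$, depending only on $d$, such that it makes at most $K n^{2d}$ steps. The elementary steps counted are operations on single bits, on indices of variables and on list and tree cells, and single arithmetic operations on rational coefficients. The set $C$ is stored as a binary search tree (trie) that is indexed by the variables occurring in the longest Boolean terms. -/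

import Mathlib

namespace LexToGrlex

/-! ### Gröbner bases -/

section Groebner

open MvPolynomial

variable {σ F : Type*} [Field F]

/-- A finite subset `G` of the ideal `I` is a Gröbner basis of `I` if the leading terms of `G`
generate the ideal generated by the leading terms of all nonzero elements of `I`. -/
def IsGroebnerBasis (m : MonomialOrder σ) (I : Ideal (MvPolynomial σ F))
    (G : Set (MvPolynomial σ F)) : Prop :=
  G.Finite ∧ G ⊆ (I : Set (MvPolynomial σ F)) ∧
    Ideal.span (m.leadingTerm '' G) =
      Ideal.span (m.leadingTerm '' {p : MvPolynomial σ F | p ∈ I ∧ p ≠ 0})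

/-- A reduced Gröbner basis: all leading coefficients are `1`, and no term of an element `f` is
divisible by the leading term of another element `g` (so that `g` cannot reduce `f`). -/
def IsReducedGroebnerBasis (m : MonomialOrder σ) (I : Ideal (MvPolynomial σ F))
    (G : Set (MvPolynomial σ F)) : Prop :=
  IsGroebnerBasis m I G ∧ (∀ g ∈ G, m.leadingCoeff g = 1) ∧
    ∀ g ∈ G, ∀ f ∈ G, f ≠ g → ∀ e ∈ f.support, ¬ m.degree g ≤ e

/-- The elements of degree at most `d` of a set of polynomials. -/
def truncate (d : ℕ) (G : Set (MvPolynomial σ F)) : Set (MvPolynomial σ F) :=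
  {g | g ∈ G ∧ g.totalDegree ≤ d}

end Groebner

/-! ### The input: a linear system over GF(2) and its lex Gröbner basis `G₁` -/

/-- A consistent linear system over GF(2) in the variables `x_0, …, x_{n-1}` in reduced row echelon
form, with `r` equations `x_i ⊕ f_i = 0` (`i < r`), where `f_i` is the sum of the `x_j`, `j ∈ supp i`,
and of the constant `const i`; only the variables `x_r, …, x_{n-1}` occur in the `f_i`. -/
structure RrefSystem (n : ℕ) where
  r : ℕ
  r_le : r ≤ n
  supp : Fin r → Finset (Fin n)
  const : Fin r → Bool
  free : ∀ i, ∀ j ∈ supp i, r ≤ j.val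

namespace RrefSystem

open MvPolynomial

variable {n : ℕ}

/-- The polynomial `M(f_i)` with real coefficients that agrees with `f_i` on `{0,1}ⁿ`. -/
noncomputable def M (S : RrefSystem n) (i : Fin S.r) : MvPolynomial (Fin n) ℝ :=
  if S.const i then
    1 + ∑ k ∈ Finset.Icc 1 (S.supp i).card, C ((-1) ^ k * 2 ^ (k - 1)) *
      ∑ T ∈ (S.supp i).powersetCard k, ∏ j ∈ T, X j
  else
    ∑ k ∈ Finset.Icc 1 (S.supp i).card, C ((-1) ^ (k - 1) * 2 ^ (k - 1)) *
      ∑ T ∈ (S.supp i).powersetCard k, ∏ j ∈ T, X j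

/-- `G₁ = {x_i - M(f_i) : i < r} ∪ {x_j² - x_j : r ≤ j}`. -/
noncomputable def G₁ (S : RrefSystem n) : Set (MvPolynomial (Fin n) ℝ) :=
  {p | ∃ i : Fin S.r, p = X (Fin.castLE S.r_le i) - S.M i} ∪
    {p | ∃ j : Fin n, S.r ≤ j.val ∧ p = X j ^ 2 - X j}

end RrefSystem

/-! ### Step counting

A program is a function with values in `Timed`. The unit of cost is one call of a recursive
function (or one pass through the main loop); outside of such calls a program only executes a
bounded number of elementary operations: case distinctions and `cons` on lists and tries,
comparisons of indices of variables, operations on bits, and rational arithmetic on coefficients. -/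

/-- A value together with the number of steps spent on computing it. -/
structure Timed (α : Type) where
  val : α
  cost : ℕ

instance : Monad Timed where
  pure a := ⟨a, 0⟩
  bind x f := ⟨(f x.val).val, x.cost + (f x.val).cost⟩

/-- One step. -/
def tick : Timed Unit := ⟨(), 1⟩

/-! #### Lists -/

def mapT {α β : Type} (f : α → Timed β) : List α → Timed (List β)
  | [] => do tick; return []
  | a :: l => do
    tick
    let b ← f a
    let bs ← mapT f l
    return b :: bs

def appendT {α : Type} : List α → List α → Timed (List α)
  | [], l => do tick; return l
  | a :: k, l => do
    tick
    let m ← appendT k l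
    return a :: m

/-- Delete the elements that satisfy `p`. -/
def deleteT {α : Type} (p : α → Timed Bool) : List α → Timed (List α)
  | [] => do tick; return []
  | a :: l => do
    tick
    let b ← p a
    let m ← deleteT p l
    if b then return m else return a :: m

def zipT {α β : Type} : List α → List β → Timed (List (α × β))
  | a :: k, b :: l => do
    tick
    let m ← zipT k l
    return (a, b) :: m
  | _, _ => do tick; return []

/-- The entry at position `i` (or the default). -/
def lookupT {α : Type} (dflt : α) : List α → ℕ → Timed α
  | [], _ => do tick; return dflt
  | a :: _, 0 => do tick; return a
  | _ :: l, i + 1 => do tick; lookupT dflt l i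

/-! #### Binary tries: finite sets of bit strings with attached data -/

inductive Trie (α : Type) where
  | empty : Trie α
  | node (val : Option α) (zero one : Trie α) : Trie α

def Trie.findT {α : Type} : Trie α → List Bool → Timed (Option α)
  | .empty, _ => do tick; return none
  | .node v _ _, [] => do tick; return v
  | .node _ z o, b :: bs => do
    tick
    if b then o.findT bs else z.findT bs

def Trie.insertT {α : Type} (a : α) : List Bool → Trie α → Timed (Trie α)
  | [], .empty => do tick; return .node (some a) .empty .empty
  | [], .node _ z o => do tick; return .node (some a) z o
  | b :: bs, .empty => do
    tick
    let t ← Trie.insertT a bs .empty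
    if b then return .node none .empty t else return .node none t .empty
  | b :: bs, .node v z o => do
    tick
    if b then
      let t ← Trie.insertT a bs o
      return .node v z t
    else
      let t ← Trie.insertT a bs z
      return .node v t o

/-! #### Monomials -/

/-- A monomial is the list of its variables, with repetitions, with weakly increasing indices. -/
abbrev Mono (n : ℕ) := List (Fin n)

section Monomials

variable {n : ℕ}

/-- All monomials of degree `k` in the given variables. -/
def monosT : ℕ → List (Fin n) → Timed (List (Mono n))
  | 0, _ => do tick; return [[]]
  | _ + 1, [] => do tick; return []
  | k + 1, x :: xs => do
    tick
    let a ← monosT k (x :: xs)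
    let a' ← mapT (fun m => pure (x :: m)) a
    let b ← monosT (k + 1) xs
    appendT a' b

/-- The list `Q` of all monomials of degree at least `1` and at most `d`. -/
def allMonosT (vars : List (Fin n)) : ℕ → Timed (List (Mono n))
  | 0 => do tick; return []
  | d + 1 => do
    tick
    let a ← allMonosT vars d
    let b ← monosT (d + 1) vars
    appendT a b

def degCompareT : Mono n → Mono n → Timed Ordering
  | [], [] => do tick; return .eq
  | [], _ :: _ => do tick; return .lt
  | _ :: _, [] => do tick; return .gt
  | _ :: a, _ :: b => do tick; degCompareT a b

/-- `a <_lex b` for monomials of the same degree (a smaller index is a larger variable). -/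
def lexLessT : Mono n → Mono n → Timed Bool
  | x :: a, y :: b => do
    tick
    if x = y then lexLessT a b else return decide (y < x)
  | _, _ => do tick; return false

/-- `a <_grlex b`. -/
def grlexLessT (a b : Mono n) : Timed Bool := do
  match ← degCompareT a b with
  | .lt => return true
  | .gt => return false
  | .eq => lexLessT a b

/-- The grlex-smallest monomial among `m` and the members of the list. -/
def smallestT (m : Mono n) : List (Mono n) → Timed (Mono n)
  | [] => do tick; return m
  | a :: l => do
    tick
    if ← grlexLessT a m then smallestT a l else smallestT m l

def equalT : Mono n → Mono n → Timed Bool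
  | [], [] => do tick; return true
  | x :: a, y :: b => do
    tick
    if x = y then equalT a b else return false
  | _, _ => do tick; return false

/-- Does `a` divide `b`? -/
def dividesT : Mono n → Mono n → Timed Bool
  | [], _ => do tick; return true
  | _ :: _, [] => do tick; return false
  | x :: a, y :: b => do
    tick
    if x = y then dividesT a b else dividesT (x :: a) b

end Monomials

/-! #### Boolean functions and Boolean terms -/

/-- The Boolean function `(⊕ x_j) ⊕ const`, where `bits` has an entry `true` for each of the `x_j`
that occur. -/
structure BoolFn where
  bits : List Bool
  const : Bool

def xorBitsT : List Bool → List Bool → Timed (List Bool)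
  | a :: k, b :: l => do
    tick
    let m ← xorBitsT k l
    return (a ^^ b) :: m
  | _, _ => do tick; return []

def BoolFn.xorT (f g : BoolFn) : Timed BoolFn := do
  let b ← xorBitsT f.bits g.bits
  return ⟨b, f.const ^^ g.const⟩

/-- The Boolean terms of the expansion
`f_1 ⋯ f_m = 2^{-(m-1)} ∑_{∅ ≠ T ⊆ [m]} (-1)^{|T|-1} ⊕_{i ∈ T} f_i`,
each with its sign; the longest Boolean term `f_1 ⊕ ⋯ ⊕ f_m` comes first. -/
def expandT : List BoolFn → Timed (List (ℚ × BoolFn))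
  | [] => do tick; return []
  | f :: fs => do
    tick
    let ts ← expandT fs
    let us ← mapT (fun p => do
      let g ← f.xorT p.2
      return (-p.1, g)) ts
    let vs ← appendT ts [(1, f)]
    appendT us vs

/-- `2^{-(m-1)}` for a monomial of degree `m`. -/
def scaleT {n : ℕ} : Mono n → Timed ℚ
  | [] => do tick; return 1
  | [_] => do tick; return 1
  | _ :: y :: l => do
    tick
    let h ← scaleT (y :: l)
    return h / 2

/-! ### The conversion algorithm -/

/-- An element `c_l = ∑_{j < l} a_j b_j|_{G₁} + lead · F` of the set `C`, where `F` is the longest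
Boolean term of `b_l|_{G₁}`: the list of the `a_j`, the coefficient `lead ≠ 0` and the constant of
`F`. In the trie that represents `C` it is stored under the bits of `F`, so that finding the element
under the bits of a Boolean term `f` means that `f` or `f ⊕ 1` is its longest Boolean term, that is,
that `f` appears in it. -/
structure CElem where
  coeffs : List ℚ
  lead : ℚ
  const : Bool

/-- A Boolean term with constant `t` that appears in `c = c_l`, as a linear combination of
`b_1|_{G₁}, …, b_l|_{G₁}`: if `F` is the longest Boolean term of `c`, then
`F = ∑_{j < l} (-a_j / lead) b_j|_{G₁} + (1 / lead) b_l|_{G₁}`, and `F ⊕ 1 = b_1 - F` as `b_1 = 1`. -/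
def CElem.substT (c : CElem) (t : Bool) : Timed (List ℚ) := do
  let v ← mapT (fun a => pure (-a / c.lead)) c.coeffs
  let w ← appendT v [1 / c.lead]
  if t = c.const then
    return w
  else
    let u ← mapT (fun a => pure (-a)) w
    match u with
    | [] => return []
    | a :: l => return (1 + a) :: l

/-- `acc + k • v`, where `v` is padded by zeros. -/
def addScaledT (k : ℚ) : List ℚ → List ℚ → Timed (List ℚ)
  | a :: as, x :: xs => do
    tick
    let m ← addScaledT k as xs
    return (a + k * x) :: m
  | as, _ => do tick; return as

/-- Add `h` times the given combination of Boolean terms to `acc`, replacing each Boolean term by a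
linear combination of the `b_j|_{G₁}`; no result if a Boolean term does not appear in `C`. -/
def combineT (C : Trie CElem) (h : ℚ) :
    List (ℚ × BoolFn) → List ℚ → Timed (Option (List ℚ))
  | [], acc => do tick; return some acc
  | (s, f) :: ts, acc => do
    tick
    match ← C.findT f.bits with
    | none => return none
    | some c =>
      let v ← c.substT f.const
      let acc' ← addScaledT (s * h) acc v
      combineT C h ts acc'

/-- A polynomial in the output: a list of coefficients and monomials. -/
abbrev OutPoly (n : ℕ) := List (ℚ × Mono n)

/-- The state of the algorithm; `B = B(G₂)` lists `b_1, b_2, …` in the order of their insertion. -/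
structure State (n : ℕ) where
  G₂ : List (OutPoly n)
  B : List (Mono n)
  C : Trie CElem
  Q : List (Mono n)

/-- What happens in one pass through the loop: the algorithm halts, or continues in a new state, or
breaks down, because it would need a step that cannot be executed. -/
inductive Outcome (n : ℕ) where
  | halt : Outcome n
  | next (s : State n) : Outcome n
  | stuck : Outcome n

/-- One pass through the loop, where `fns` is the list of the Boolean functions of all variables. -/
def bodyT {n : ℕ} (fns : List BoolFn) (s : State n) : Timed (Outcome n) := do
  tick
  match s.Q with
  | [] => return .halt
  | m :: ms =>
    -- next monomial
    let q ← smallestT m ms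
    -- the expansion of `q|_{G₁}` into Boolean terms
    let fs ← mapT (fun i => lookupT ⟨[], false⟩ fns i.val) q
    let ts ← expandT fs
    let h ← scaleT q
    match ts with
    | [] => return .stuck
    | (σ, F) :: rest =>
      -- all Boolean terms except for the longest one
      let zero ← mapT (fun _ => pure 0) s.B
      match ← combineT s.C h rest zero with
      | none => return .stuck
      | some acc =>
        match ← s.C.findT F.bits with
        | none =>
          -- the longest Boolean term does not appear in `C`
          let C' ← s.C.insertT ⟨acc, σ * h, F.const⟩ F.bits
          let B' ← appendT s.B [q]
          let Q' ← deleteT (fun a => equalT q a) s.Q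
          return .next ⟨s.G₂, B', C', Q'⟩
        | some c =>
          -- it appears: `q|_{G₁} = ∑ k_j b_j|_{G₁}`, so `q - ∑ k_j b_j` is added to `G₂`
          let v ← c.substT F.const
          let k ← addScaledT (σ * h) acc v
          let k' ← mapT (fun a => pure (-a)) k
          let g ← zipT k' s.B
          let Q' ← deleteT (fun a => dividesT q a) s.Q
          return .next ⟨((1, q) :: g) :: s.G₂, s.B, s.C, Q'⟩

/-- The initial state: `G₂ = ∅`, `B(G₂) = {1}`, `C = {1}`, `Q` as above. -/
def initT {n : ℕ} (d : ℕ) (vars : List (Fin n)) : Timed (State n) := do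
  let Q ← allMonosT vars d
  let key ← mapT (fun _ => pure false) vars
  let C ← Trie.insertT ⟨[], 1, true⟩ key .empty
  return ⟨[], [[]], C, Q⟩

/-- `Runs fns s t k`: started in the state `s`, the loop halts in the state `t` after `k` steps. -/
inductive Runs {n : ℕ} (fns : List BoolFn) : State n → State n → ℕ → Prop where
  | halt (s : State n) (h : (bodyT fns s).val = .halt) : Runs fns s s (bodyT fns s).cost
  | next (s s' t : State n) (k : ℕ) (h : (bodyT fns s).val = .next s') (h' : Runs fns s' t k) :
      Runs fns s t ((bodyT fns s).cost + k)

/-- The Boolean functions `f_0, …, f_{n-1}` of the system, where `f_i = x_i` for `i ≥ r`. In this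
form the set `G₁` is given to the algorithm. -/
def RrefSystem.fns {n : ℕ} (S : RrefSystem n) : List BoolFn :=
  (List.finRange n).map fun i =>
    if h : i.val < S.r then
      ⟨(List.finRange n).map fun j => decide (j ∈ S.supp ⟨i.val, h⟩), S.const ⟨i.val, h⟩⟩
    else
      ⟨(List.finRange n).map fun j => decide (j = i), false⟩

/-- `Terminates d S t k`: on the input consisting of `d` and `G₁` (for the system `S`), the
conversion algorithm terminates after `k` steps, in the final state `t`. -/
def Terminates {n : ℕ} (d : ℕ) (S : RrefSystem n) (t : State n) (k : ℕ) : Prop :=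
  ∃ k', Runs S.fns (initT d (List.finRange n)).val t k' ∧
    k = (initT d (List.finRange n)).cost + k'

open MvPolynomial in
/-- The polynomial that is denoted by a list of coefficients and monomials. -/
noncomputable def OutPoly.toPoly {n : ℕ} (g : OutPoly n) : MvPolynomial (Fin n) ℝ :=
  (g.map fun p => C (p.1 : ℝ) * (p.2.map X).prod).sum

/-- The set of polynomials `G₂` that is the output in the final state `t`. -/
def State.output {n : ℕ} (t : State n) : Set (MvPolynomial (Fin n) ℝ) :=
  {p | ∃ g ∈ t.G₂, p = OutPoly.toPoly g}

end LexToGrlex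

/-! The argument turns ideal membership into linear algebra of characters. The solutions of the
system are parametrised by sign vectors `y`, a bit `x` being recorded by the sign `1 - 2x`. A XOR of
variables then becomes a product of signs, so every Boolean function takes the values `(1 ∓ χ(y)) /
2` for a character `χ` of a group of sign vectors. By `mem_span_G₁_iff` the ideal of `G₁` consists
of exactly the polynomials that vanish at all solutions, so congruences modulo `G₁` are identities
between functions of `y`.

Let `key q` be the bit string of the XOR of all factors of a monomial `q`. The expansion of `q` into
Boolean terms involves the character of `key q` with nonzero coefficient, and otherwise only keys of
proper divisors of `q` (`exists_expandT`, `prod_value_eq`). When `q` is the grlex-smallest monomial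
left in `Q`, all these divisors are in `B`, so their terms can be replaced.

If `key q` is new, then `q` is standard: a leading monomial would be congruent to smaller standard
monomials, all of them in `B`, so the character of `key q` would lie in the span of the characters
of `B`. Distinct characters are linearly independent (`exists_key_eq_of_mem_keySpan`), a
contradiction. If `key q` is known, then `q` is a combination of `B` on the solutions. Its proper
divisors are standard, so `q` is a minimal leading monomial and the polynomial found is the element
of the reduced basis that belongs to it (`sub_mem_reducedBasis`). `Invariant` records this;
`exists_next` preserves it, and `output_eq` reads off the result when `Q` is empty.

For fixed `d` there are `O(n^d)` monomials, and a pass handles boundedly many lists of length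
`O(n^d)`, which gives `O(n^{2d})`. -/

namespace LexToGrlex

/-! ### Standard monomials and the reduced Gröbner basis of an ideal -/

section Groebner

open MvPolynomial
open scoped MonomialOrder

variable {σ F : Type*} [Field F]

/-- The exponents of the leading monomials of the nonzero elements of an ideal. -/
def initialExps (m : MonomialOrder σ) (I : Ideal (MvPolynomial σ F)) : Set (σ →₀ ℕ) :=
  {a | ∃ p ∈ I, p ≠ 0 ∧ m.degree p = a}

/-- The monic elements of an ideal whose leading monomial is a minimal leading monomial and whose
other monomials are standard. -/
def reducedBasis (m : MonomialOrder σ) (I : Ideal (MvPolynomial σ F)) :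
    Set (MvPolynomial σ F) :=
  {p | p ∈ I ∧ m.leadingCoeff p = 1 ∧
    (∀ b ∈ initialExps m I, b ≤ m.degree p → b = m.degree p) ∧
    ∀ b ∈ p.support, b ∈ initialExps m I → b = m.degree p}

variable {m : MonomialOrder σ} {I : Ideal (MvPolynomial σ F)}

lemma initialExps_add {a : σ →₀ ℕ} (ha : a ∈ initialExps m I) (c : σ →₀ ℕ) :
    c + a ∈ initialExps m I := by
  obtain ⟨p, hp, h0, rfl⟩ := ha
  have hm : (monomial c (1 : F)) ≠ 0 := by simp
  refine ⟨monomial c 1 * p, I.mul_mem_left _ hp, mul_ne_zero hm h0, ?_⟩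
  classical
  rw [m.degree_mul hm h0, m.degree_monomial, if_neg one_ne_zero]

lemma initialExps_mono {a b : σ →₀ ℕ} (ha : a ∈ initialExps m I) (h : a ≤ b) :
    b ∈ initialExps m I := by
  obtain ⟨c, rfl⟩ := exists_add_of_le h
  rw [add_comm]
  exact initialExps_add ha c

lemma eq_zero_of_standard {p : MvPolynomial σ F} (hp : p ∈ I)
    (h : ∀ b ∈ p.support, b ∉ initialExps m I) : p = 0 := by
  by_contra h0
  exact h _ (m.degree_mem_support h0) ⟨p, hp, h0, rfl⟩

/-- Every polynomial is congruent to a combination of standard monomials that are not larger than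
its leading monomial. -/
lemma exists_normalForm (m : MonomialOrder σ) (I : Ideal (MvPolynomial σ F))
    (f : MvPolynomial σ F) :
    ∃ r : MvPolynomial σ F, f - r ∈ I ∧ m.degree r ≼[m] m.degree f ∧
      ∀ b ∈ r.support, b ∉ initialExps m I := by
  obtain ⟨g, r, h1, h2, h3⟩ := m.div_set (B := {p | p ∈ I ∧ p ≠ 0})
    (fun b hb => isUnit_iff_ne_zero.2 (m.leadingCoeff_ne_zero_iff.2 hb.2)) f
  have hs : f - r = Finsupp.linearCombination (MvPolynomial σ F)
      (fun b : {p : MvPolynomial σ F | p ∈ I ∧ p ≠ 0} => (b : MvPolynomial σ F)) g := by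
    rw [h1]; ring
  refine ⟨r, ?_, ?_, ?_⟩
  · rw [hs, Finsupp.linearCombination_apply]
    exact I.sum_mem fun b _ => I.mul_mem_left _ b.2.1
  · have hr : r = f - Finsupp.linearCombination (MvPolynomial σ F)
        (fun b : {p : MvPolynomial σ F | p ∈ I ∧ p ≠ 0} => (b : MvPolynomial σ F)) g := by
      rw [← hs]; ring
    rw [hr]
    refine m.degree_sub_le.trans (sup_le le_rfl ?_)
    rw [Finsupp.linearCombination_apply, Finsupp.sum]
    refine m.degree_sum_le.trans (Finset.sup_le fun b _ => ?_)
    rw [smul_eq_mul, mul_comm]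
    exact h2 b
  · rintro b hb ⟨p, hp, h0, rfl⟩
    exact h3 _ hb p ⟨hp, h0⟩ le_rfl

/-- A leading monomial of the ideal is congruent to a combination of smaller standard monomials. -/
lemma exists_reduction {a : σ →₀ ℕ} (ha : a ∈ initialExps m I) :
    ∃ r : MvPolynomial σ F, monomial a 1 - r ∈ I ∧
      (∀ b ∈ r.support, b ∉ initialExps m I ∧ b ≺[m] a) := by
  classical
  obtain ⟨r, h1, h2, h3⟩ := exists_normalForm m I (monomial a (1 : F))
  refine ⟨r, h1, fun b hb => ⟨h3 b hb, ?_⟩⟩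
  rw [m.degree_monomial, if_neg one_ne_zero] at h2
  refine lt_of_le_of_ne ((m.le_degree hb).trans h2) fun h => ?_
  exact h3 b hb (m.toSyn.injective h ▸ ha)

lemma degree_monomial_sub {a : σ →₀ ℕ} {r : MvPolynomial σ F}
    (h : ∀ b ∈ r.support, b ≺[m] a) :
    m.degree (monomial a 1 - r) = a ∧ m.leadingCoeff (monomial a 1 - r) = 1 := by
  classical
  by_cases h0 : r = 0
  · subst h0
    simp [m.degree_monomial]
  have hd : m.degree r ≺[m] m.degree (monomial a (1 : F)) := by
    rw [m.degree_monomial, if_neg one_ne_zero]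
    exact h _ (m.degree_mem_support h0)
  rw [m.degree_sub_of_lt hd, m.leadingCoeff_sub_of_lt hd]
  simp [m.degree_monomial]

/-- The certificate for output polynomials: as the tail `r` is standard and smaller, `a` is the
leading exponent and the only exponent in the support that can belong to the initial ideal. -/
lemma sub_mem_reducedBasis {a : σ →₀ ℕ} {r : MvPolynomial σ F}
    (hI : monomial a 1 - r ∈ I) (hr : ∀ b ∈ r.support, b ∉ initialExps m I ∧ b ≺[m] a)
    (hmin : ∀ b ∈ initialExps m I, b ≤ a → b = a) :
    monomial a 1 - r ∈ reducedBasis m I := by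
  classical
  obtain ⟨h1, h2⟩ := degree_monomial_sub (m := m) fun b hb => (hr b hb).2
  refine ⟨hI, h2, by rwa [h1], fun b hb hb' => ?_⟩
  rw [h1]
  by_contra hne
  have : b ∈ r.support := by
    rw [mem_support_iff, coeff_sub, coeff_monomial, if_neg (Ne.symm hne), zero_sub,
      neg_ne_zero] at hb
    exact mem_support_iff.2 hb
  exact (hr b this).1 hb'

lemma degree_mem_of_mem_reducedBasis {p : MvPolynomial σ F} (hp : p ∈ reducedBasis m I) :
    m.degree p ∈ initialExps m I := by
  refine ⟨p, hp.1, ?_, rfl⟩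
  rintro rfl
  simpa using hp.2.1

/-- In `p - q` the equal monic leading terms cancel and all other monomials are standard, so this
element of the ideal has no possible leading monomial. -/
lemma eq_of_mem_reducedBasis {p q : MvPolynomial σ F} (hp : p ∈ reducedBasis m I)
    (hq : q ∈ reducedBasis m I) (h : m.degree p = m.degree q) : p = q := by
  classical
  rw [← sub_eq_zero]
  refine eq_zero_of_standard (m := m) (I.sub_mem hp.1 hq.1) fun b hb hb' => ?_
  have hb0 : b = m.degree p := by
    rcases Finset.mem_union.1 (support_sub _ _ _ hb) with h1 | h1
    · exact hp.2.2.2 b h1 hb'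
    · rw [h]; exact hq.2.2.2 b h1 hb'
  have e1 := hp.2.1
  have e2 := hq.2.1
  rw [MonomialOrder.leadingCoeff] at e1 e2
  rw [mem_support_iff, coeff_sub, hb0, e1, h, e2] at hb
  exact hb (sub_self _)

lemma exists_minimal_le {s : Set (σ →₀ ℕ)} {a : σ →₀ ℕ} (ha : a ∈ s) :
    ∃ b ∈ s, b ≤ a ∧ ∀ c ∈ s, c ≤ b → c = b := by
  obtain ⟨b, hb, hmin⟩ := exists_minimal_le_of_wellFoundedLT (· ∈ s) a ha
  exact ⟨b, hmin.1, hb, fun c hc hcb => le_antisymm hcb (hmin.2 hc hcb)⟩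

/-- The leading exponents are minimal, hence an antichain, and finite by Dickson's lemma. Below
every leading exponent of the ideal lies a minimal one, and subtracting its normal form from that
monomial gives an element of the set. -/
theorem isReducedGroebnerBasis_reducedBasis [Finite σ] (m : MonomialOrder σ)
    (I : Ideal (MvPolynomial σ F)) : IsReducedGroebnerBasis m I (reducedBasis m I) := by
  classical
  refine ⟨⟨?_, fun p hp => hp.1, ?_⟩, fun p hp => hp.2.1, ?_⟩
  · refine Set.Finite.of_finite_image (f := m.degree) ?_
      fun p hp q hq h => eq_of_mem_reducedBasis hp hq h
    have hac : IsAntichain (· ≤ ·) (m.degree '' reducedBasis m I) := by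
      rintro _ ⟨p, hp, rfl⟩ _ ⟨q, hq, rfl⟩ hne hle
      exact hne (hq.2.2.1 _ (degree_mem_of_mem_reducedBasis hp) hle)
    exact hac.finite_of_partiallyWellOrderedOn (Set.isPWO_of_wellQuasiOrderedLE _)
  · apply le_antisymm
    · rw [Ideal.span_le]
      rintro _ ⟨p, hp, rfl⟩
      refine Ideal.subset_span ⟨p, ⟨hp.1, ?_⟩, rfl⟩
      rintro rfl
      simpa using hp.2.1
    · rw [Ideal.span_le]
      rintro _ ⟨p, ⟨hp, h0⟩, rfl⟩
      obtain ⟨a, ha, hle, hmin⟩ :=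
        exists_minimal_le (show m.degree p ∈ initialExps m I from ⟨p, hp, h0, rfl⟩)
      obtain ⟨r, hr, hr'⟩ := exists_reduction ha
      obtain ⟨h1, h2⟩ := degree_monomial_sub (m := m) fun b hb => (hr' b hb).2
      have hmem := sub_mem_reducedBasis hr hr' hmin
      obtain ⟨c, hc⟩ := exists_add_of_le hle
      have : m.leadingTerm p = monomial c (m.leadingCoeff p) *
          m.leadingTerm (monomial a 1 - r) := by
        rw [MonomialOrder.leadingTerm, MonomialOrder.leadingTerm, h1, h2, monomial_mul, mul_one,
          hc, add_comm]
      rw [SetLike.mem_coe, this]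
      exact Ideal.mul_mem_left _ _ (Ideal.subset_span ⟨_, hmem, rfl⟩)
  · intro g hg f hf hne e he hle
    have h1 := initialExps_mono (degree_mem_of_mem_reducedBasis hg) hle
    have h2 := hf.2.2.2 e he h1
    rw [h2] at hle
    exact hne (eq_of_mem_reducedBasis hf hg (hf.2.2.1 _ (degree_mem_of_mem_reducedBasis hg) hle).symm)

end Groebner

end LexToGrlex

namespace LexToGrlex

/-! ### Characters and values of Boolean functions -/

/-- The sign of the `k`-th coordinate, as a real character. -/
noncomputable def signHom (k : ℕ) : (ℕ → ℤˣ) →* ℝ :=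
  ((Int.castRingHom ℝ).toMonoidHom.comp (Units.coeHom ℤ)).comp (Pi.evalMonoidHom _ k)

/-- The character belonging to a bit string that starts at the `k`-th coordinate. -/
noncomputable def chi : ℕ → List Bool → (ℕ → ℤˣ) →* ℝ
  | _, [] => 1
  | k, b :: bs => (if b then signHom k else 1) * chi (k + 1) bs

lemma signHom_apply (k : ℕ) (y : ℕ → ℤˣ) : signHom k y = ((y k : ℤ) : ℝ) := rfl

lemma signHom_mul_self (k : ℕ) : signHom k * signHom k = 1 := by
  ext y
  rcases Int.units_eq_one_or (y k) with h | h <;> simp [signHom_apply, h]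

lemma chi_apply_of_eq_one (k : ℕ) (l : List Bool) (y : ℕ → ℤˣ) (hy : ∀ j, k ≤ j → y j = 1) :
    chi k l y = 1 := by
  induction l generalizing k with
  | nil => simp [chi]
  | cons b l ih =>
    rw [chi, MonoidHom.mul_apply, ih (k + 1) fun j hj => hy j (by omega)]
    cases b <;> simp [signHom_apply, hy k le_rfl]

/-- Flipping only the `k`-th sign reveals the first bit, since the tail depends on later signs only;
the common factor, with values `±1`, then cancels. Equal lengths matter because trailing `false`
bits do not change the character. -/
lemma chi_injective {k : ℕ} {l l' : List Bool} (hl : l.length = l'.length)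
    (h : chi k l = chi k l') : l = l' := by
  induction l generalizing k l' with
  | nil => exact (List.length_eq_zero_iff.1 hl.symm).symm
  | cons b l ih =>
    match l', hl with
    | b' :: l', hl =>
      have hb : b = b' := by
        have := DFunLike.congr_fun h (Function.update (1 : ℕ → ℤˣ) k (-1))
        have h1 : ∀ j, k + 1 ≤ j → Function.update (1 : ℕ → ℤˣ) k (-1) j = 1 := fun j hj => by
          rw [Function.update_of_ne (by omega)]; rfl
        rw [chi, chi, MonoidHom.mul_apply, MonoidHom.mul_apply, chi_apply_of_eq_one _ _ _ h1,
          chi_apply_of_eq_one _ _ _ h1] at this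
        cases b <;> cases b' <;> simp [signHom_apply] at this ⊢ <;> norm_num at this
      subst hb
      rw [chi, chi] at h
      have h2 : chi (k + 1) l = chi (k + 1) l' := by
        ext y
        have := DFunLike.congr_fun h y
        rw [MonoidHom.mul_apply, MonoidHom.mul_apply] at this
        refine mul_left_cancel₀ ?_ this
        cases b
        · simp
        · rcases Int.units_eq_one_or (y k) with h | h <;> simp [signHom_apply, h]
      rw [ih (by simpa using hl) h2]

lemma chi_ofFn {n : ℕ} (k : ℕ) (b : Fin n → Bool) (y : ℕ → ℤˣ) :
    chi k (List.ofFn b) y = ∏ j, if b j then signHom (k + j) y else 1 := by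
  induction n generalizing k with
  | zero => simp [chi]
  | succ n ih =>
    rw [List.ofFn_succ, chi, MonoidHom.mul_apply, ih, Fin.prod_univ_succ]
    congr 1
    · cases b 0 <;> simp
    · refine Finset.prod_congr rfl fun j _ => ?_
      rw [Fin.val_succ, show k + 1 + (j : ℕ) = k + (j + 1) by omega]

/-- The sign that represents a bit. -/
def bitSign (b : Bool) : ℝ := if b then -1 else 1

lemma bitSign_xor (a b : Bool) : bitSign (a ^^ b) = bitSign a * bitSign b := by
  cases a <;> cases b <;> simp [bitSign]

lemma bitSign_mul_self (a : Bool) : bitSign a * bitSign a = 1 := by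
  cases a <;> simp [bitSign]

/-- The value of a Boolean function at a vector of signs, where the `j`-th variable has the value
`(1 - y_j) / 2`. -/
noncomputable def BoolFn.value (f : BoolFn) (y : ℕ → ℤˣ) : ℝ :=
  (1 - bitSign f.const * chi 0 f.bits y) / 2

/-! ### The ideal of `G₁` as the vanishing ideal of the solutions -/

namespace RrefSystem

open MvPolynomial

variable {n : ℕ} (S : RrefSystem n)

/-- The Boolean function `f_i`. -/
def fn (i : Fin n) : BoolFn :=
  if h : i.val < S.r then
    ⟨(List.finRange n).map fun j => decide (j ∈ S.supp ⟨i.val, h⟩), S.const ⟨i.val, h⟩⟩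
  else
    ⟨(List.finRange n).map fun j => decide (j = i), false⟩

lemma fns_eq : S.fns = (List.finRange n).map S.fn := rfl

lemma length_fn_bits (i : Fin n) : (S.fn i).bits.length = n := by
  unfold fn
  split <;> simp

/-- The solution of the system that is given by the signs of the free variables. -/
noncomputable def point (y : ℕ → ℤˣ) (i : Fin n) : ℝ := (S.fn i).value y

lemma point_free (y : ℕ → ℤˣ) {i : Fin n} (hi : S.r ≤ i.val) :
    S.point y i = (1 - signHom i y) / 2 := by
  rw [point, fn, dif_neg hi.not_gt, BoolFn.value, ← List.ofFn_eq_map, chi_ofFn]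
  simp [bitSign]

lemma point_bound (y : ℕ → ℤˣ) (i : Fin S.r) :
    S.point y (Fin.castLE S.r_le i) =
      (1 - bitSign (S.const i) * ∏ j ∈ S.supp i, signHom j y) / 2 := by
  rw [point, fn, dif_pos (show (Fin.castLE S.r_le i).val < S.r from i.2), BoolFn.value,
    ← List.ofFn_eq_map, chi_ofFn]
  simp [Finset.prod_ite_mem]

/-- A XOR is half of one minus the product of the signs `1 - 2 x_j`. Expanding the product produces
the coefficients `(-2)^k`, and the factor `∓1/2` turns them into those of `M`. -/
lemma M_eq (i : Fin S.r) :
    S.M i = C (1 / 2) * (1 - C (bitSign (S.const i)) * ∏ j ∈ S.supp i, (1 - C 2 * X j)) := by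
  have key : ∏ j ∈ S.supp i, (1 - C 2 * X j : MvPolynomial (Fin n) ℝ) =
      1 + ∑ k ∈ Finset.Icc 1 (S.supp i).card, C ((-2) ^ k) *
        ∑ T ∈ (S.supp i).powersetCard k, ∏ j ∈ T, X j := by
    have h0 : ∏ j ∈ S.supp i, (1 - C 2 * X j : MvPolynomial (Fin n) ℝ) =
        ∏ j ∈ S.supp i, (1 + C (-2) * X j) := by
      refine Finset.prod_congr rfl fun j _ => ?_
      rw [C_neg]; ring
    rw [h0, Finset.prod_one_add, Finset.sum_powerset, Finset.range_eq_Ico,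
      Finset.sum_eq_sum_Ico_succ_bot (Nat.succ_pos _),
      show Finset.Ico (0 + 1) ((S.supp i).card + 1) = Finset.Icc 1 (S.supp i).card by
        ext k; simp only [Finset.mem_Ico, Finset.mem_Icc]; omega]
    congr 1
    · simp
    · refine Finset.sum_congr rfl fun k _ => ?_
      rw [Finset.mul_sum]
      refine Finset.sum_congr rfl fun T hT => ?_
      rw [Finset.prod_mul_distrib, Finset.prod_const, (Finset.mem_powersetCard.1 hT).2, C_pow]
  have hk : ∀ k ∈ Finset.Icc 1 (S.supp i).card, (-2 : ℝ) ^ k = -2 * ((-1) ^ (k - 1) * 2 ^ (k - 1)) ∧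
      (-1 : ℝ) ^ k * 2 ^ (k - 1) = (1 / 2) * (-2) ^ k := by
    intro k hk
    -- Writing `k = l + 1` removes the truncated subtraction.
    obtain ⟨l, rfl⟩ := Nat.exists_eq_add_of_le' (Finset.mem_Icc.1 hk).1
    rw [Nat.add_sub_cancel, ← mul_pow]
    constructor
    · ring
    · rw [pow_succ, pow_succ, mul_right_comm, ← mul_pow]; ring
  rw [key, M]
  have hhalf : (C (1 / 2) * C 2 : MvPolynomial (Fin n) ℝ) = 1 := by
    rw [← C_mul]; norm_num
  cases S.const i
  · rw [if_neg (by simp), bitSign, if_neg (by simp), C_1, one_mul, sub_add_cancel_left, mul_neg, Finset.mul_sum,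
      ← Finset.sum_neg_distrib]
    refine Finset.sum_congr rfl fun k h => ?_
    rw [(hk k h).1, ← mul_assoc, ← neg_mul, ← C_mul, ← C_neg]
    congr 2; ring
  · rw [if_pos rfl, bitSign, if_pos rfl, C_neg, C_1, neg_one_mul, sub_neg_eq_add,
      ← add_assoc, mul_add]
    congr 1
    · rw [show (1 + 1 : MvPolynomial (Fin n) ℝ) = C 2 by rw [← one_add_one_eq_two, C_add, C_1], hhalf]
    · rw [Finset.mul_sum]
      refine Finset.sum_congr rfl fun k h => ?_
      rw [(hk k h).2, ← mul_assoc, ← C_mul]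

lemma eval_M (y : ℕ → ℤˣ) (i : Fin S.r) :
    eval (S.point y) (S.M i) = S.point y (Fin.castLE S.r_le i) := by
  rw [M_eq, point_bound, map_mul, map_sub, map_mul, map_prod]
  simp only [eval_C, map_one, map_sub, map_mul, eval_X]
  rw [Finset.prod_congr rfl (g := fun j : Fin n => signHom j y) fun j hj => ?_]
  · ring
  · rw [S.point_free y (S.free i j hj)]; ring

lemma eval_eq_zero_of_mem_span {p : MvPolynomial (Fin n) ℝ} (hp : p ∈ Ideal.span S.G₁)
    (y : ℕ → ℤˣ) : eval (S.point y) p = 0 := by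
  suffices Ideal.span S.G₁ ≤ RingHom.ker (eval (S.point y)) from this hp
  rw [Ideal.span_le]
  rintro _ (⟨i, rfl⟩ | ⟨j, hj, rfl⟩)
  · rw [SetLike.mem_coe, RingHom.mem_ker, map_sub, eval_X, eval_M, sub_self]
  · rw [SetLike.mem_coe, RingHom.mem_ker, map_sub, map_pow, eval_X, S.point_free y hj]
    have : signHom j y * signHom j y = 1 := by
      rw [← MonoidHom.mul_apply, signHom_mul_self, MonoidHom.one_apply]
    linear_combination this / 4

/-- Substitution of `M(f_i)` for the bound variables. -/
noncomputable def substBound : MvPolynomial (Fin n) ℝ →ₐ[ℝ] MvPolynomial (Fin n) ℝ :=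
  aeval fun i => if h : i.val < S.r then S.M ⟨i.val, h⟩ else X i

/-- Substitution of zero for the bound variables. -/
noncomputable def killBound : MvPolynomial (Fin n) ℝ →ₐ[ℝ] MvPolynomial (Fin n) ℝ :=
  aeval fun i => if i.val < S.r then 0 else X i

lemma killBound_M (i : Fin S.r) : S.killBound (S.M i) = S.M i := by
  rw [M_eq]
  simp only [map_mul, map_sub, map_prod, map_one, algHom_C, algebraMap_eq]
  rw [Finset.prod_congr rfl (g := fun j : Fin n => (1 - C 2 * X j : MvPolynomial (Fin n) ℝ))
    fun j hj => ?_]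
  rw [killBound, aeval_X, if_neg (S.free i j hj).not_gt]

/-- After the substitution only free variables are left. This makes it possible to discard the
relations `x_i² - x_i` of bound variables, which are not in `G₁`. -/
lemma killBound_substBound (p : MvPolynomial (Fin n) ℝ) :
    S.killBound (S.substBound p) = S.substBound p := by
  rw [← AlgHom.comp_apply]
  congr 1
  ext i : 1
  rw [AlgHom.comp_apply, substBound, aeval_X]
  split
  · rw [killBound_M]
  · rw [killBound, aeval_X, if_neg ‹_›]

lemma sub_substBound_mem (p : MvPolynomial (Fin n) ℝ) :
    p - S.substBound p ∈ Ideal.span S.G₁ := by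
  rw [← Ideal.Quotient.eq, ← Ideal.Quotient.mkₐ_eq_mk ℝ, ← AlgHom.comp_apply]
  congr 1
  ext i : 1
  rw [AlgHom.comp_apply, substBound, aeval_X]
  split
  · rename_i h
    rw [Ideal.Quotient.mkₐ_eq_mk, Ideal.Quotient.eq]
    exact Ideal.subset_span (Or.inl ⟨⟨i, h⟩, rfl⟩)
  · rfl

/-- The bound coordinates of `x` are arbitrary: this extends vanishing at the solutions to vanishing
on the whole cube. -/
lemma eval_substBound {y : ℕ → ℤˣ} {x : Fin n → ℝ}
    (hx : ∀ i : Fin n, S.r ≤ i.val → x i = S.point y i) (p : MvPolynomial (Fin n) ℝ) :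
    eval x (S.substBound p) = eval (S.point y) p := by
  suffices (aeval x).comp S.substBound = aeval (S.point y) by
    simpa [aeval_eq_eval] using AlgHom.congr_fun this p
  ext i : 1
  rw [AlgHom.comp_apply, substBound, aeval_X, aeval_X]
  split
  · rename_i h
    rw [show S.point y i = S.point y (Fin.castLE S.r_le ⟨i, h⟩) from rfl, ← eval_M, M_eq]
    simp only [map_mul, map_sub, map_prod, map_one, aeval_X, eval_X, aeval_C, eval_C]
    rw [Finset.prod_congr rfl fun j hj => ?_]
    · rfl
    · rw [hx j (S.free _ j hj)]; rfl
  · rw [aeval_X, hx i (not_lt.1 ‹_›)]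

/-- For the converse, `p` is replaced by its substituted form, which is congruent to it and vanishes
on `{0,1}ⁿ`. The combinatorial Nullstellensatz writes that form as a combination of the products
`x_i (x_i - 1)`. -/
theorem mem_span_G₁_iff (p : MvPolynomial (Fin n) ℝ) :
    p ∈ Ideal.span S.G₁ ↔ ∀ y, eval (S.point y) p = 0 := by
  refine ⟨fun h => S.eval_eq_zero_of_mem_span h, fun h => ?_⟩
  suffices S.substBound p ∈ Ideal.span S.G₁ by
    simpa using Ideal.add_mem _ (S.sub_substBound_mem p) this
  obtain ⟨g, -, hg⟩ := combinatorial_nullstellensatz_exists_linearCombination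
    (fun _ : Fin n => ({0, 1} : Finset ℝ)) (fun _ => by simp) (S.substBound p) (by
      intro x hx
      -- Signs that agree with the vertex `x` at the free coordinates; the values beyond `n` are
      -- irrelevant.
      rw [S.eval_substBound (y := fun k => if h : k < n then
        (if x ⟨k, h⟩ = 0 then 1 else -1) else 1) fun i hi => ?_]
      · exact h _
      · rw [S.point_free _ hi, signHom_apply]
        have := hx i
        simp only [Finset.mem_insert, Finset.mem_singleton] at this
        rcases this with h | h <;> simp [h])
  -- Killing the bound variables fixes the left side, annihilates `x_i (x_i - 1)` for bound `i`, and
  -- leaves it as an element of `G₁` for free `i`.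
  rw [← killBound_substBound, hg, Finsupp.linearCombination_apply, Finsupp.sum, map_sum]
  refine Ideal.sum_mem _ fun i _ => ?_
  rw [smul_eq_mul, map_mul]
  refine Ideal.mul_mem_left _ _ ?_
  rw [Finset.prod_pair zero_ne_one, map_mul]
  by_cases hi : i.val < S.r
  · have : S.killBound (X i - C 0) = 0 := by simp [killBound, hi]
    rw [this, zero_mul]
    exact Ideal.zero_mem _
  · have : S.killBound (X i - C 0) * S.killBound (X i - C 1) = X i ^ 2 - X i := by
      simp [killBound, hi]; ring
    rw [this]
    exact Ideal.subset_span (Or.inr ⟨i, not_lt.1 hi, rfl⟩)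

end RrefSystem

end LexToGrlex

namespace LexToGrlex

/-! ### Values and costs of the elementary programs -/

section Programs

variable {α β : Type}

@[simp] lemma Timed.pure_val (a : α) : (pure a : Timed α).val = a := rfl

@[simp] lemma Timed.pure_cost (a : α) : (pure a : Timed α).cost = 0 := rfl

@[simp] lemma Timed.bind_val (x : Timed α) (f : α → Timed β) :
    (x >>= f).val = (f x.val).val := rfl

@[simp] lemma Timed.bind_cost (x : Timed α) (f : α → Timed β) :
    (x >>= f).cost = x.cost + (f x.val).cost := rfl

@[simp] lemma tick_cost : tick.cost = 1 := rfl

@[simp] lemma mapT_val (f : α → Timed β) (l : List α) :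
    (mapT f l).val = l.map fun a => (f a).val := by
  induction l with
  | nil => rfl
  | cons a l ih => simp [mapT, ih]

lemma mapT_cost_le {f : α → Timed β} {l : List α} {c : ℕ} (h : ∀ a ∈ l, (f a).cost ≤ c) :
    (mapT f l).cost ≤ l.length * (c + 1) + 1 := by
  induction l with
  | nil => simp [mapT]
  | cons a l ih =>
    have h1 := h a (by simp)
    have h2 := ih fun b hb => h b (by simp [hb])
    simp only [mapT, Timed.bind_cost, tick_cost, Timed.pure_cost, List.length_cons]
    linarith

lemma mapT_pure_cost (f : α → β) (l : List α) :
    (mapT (fun a => pure (f a)) l).cost = l.length + 1 := by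
  induction l with
  | nil => rfl
  | cons a l ih =>
    simp only [mapT, Timed.bind_cost, tick_cost, Timed.pure_cost, ih, List.length_cons]
    omega

@[simp] lemma appendT_val (k l : List α) : (appendT k l).val = k ++ l := by
  induction k with
  | nil => rfl
  | cons a k ih => simp [appendT, ih]

@[simp] lemma appendT_cost (k l : List α) : (appendT k l).cost = k.length + 1 := by
  induction k with
  | nil => rfl
  | cons a k ih => simp [appendT, ih]; omega

@[simp] lemma deleteT_val (p : α → Timed Bool) (l : List α) :
    (deleteT p l).val = l.filter fun a => !(p a).val := by
  induction l with
  | nil => rfl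
  | cons a l ih =>
    simp only [deleteT, Timed.bind_val, List.filter_cons]
    cases h : (p a).val <;> simp [ih]

lemma deleteT_cost_le {p : α → Timed Bool} {l : List α} {c : ℕ} (h : ∀ a ∈ l, (p a).cost ≤ c) :
    (deleteT p l).cost ≤ l.length * (c + 1) + 1 := by
  induction l with
  | nil => simp [deleteT]
  | cons a l ih =>
    have h1 := h a (by simp)
    have h2 := ih fun b hb => h b (by simp [hb])
    simp only [deleteT, Timed.bind_cost, tick_cost, List.length_cons]
    split <;> simp only [Timed.pure_cost] <;> linarith

@[simp] lemma zipT_val (k : List α) (l : List β) : (zipT k l).val = k.zip l := by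
  induction k generalizing l with
  | nil => simp [zipT]
  | cons a k ih => cases l <;> simp [zipT, ih]

lemma zipT_cost_le (k : List α) (l : List β) : (zipT k l).cost ≤ k.length + 1 := by
  induction k generalizing l with
  | nil => simp [zipT]
  | cons a k ih =>
    cases l with
    | nil => simp [zipT]
    | cons b l =>
      have := ih l
      simp [zipT]; omega

@[simp] lemma lookupT_val (x : α) (l : List α) (i : ℕ) : (lookupT x l i).val = l.getD i x := by
  induction l generalizing i with
  | nil => simp [lookupT]
  | cons a l ih => cases i <;> simp [lookupT, ih]

lemma lookupT_cost_le (x : α) (l : List α) (i : ℕ) : (lookupT x l i).cost ≤ l.length + 1 := by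
  induction l generalizing i with
  | nil => simp [lookupT]
  | cons a l ih =>
    cases i with
    | zero => simp [lookupT]
    | succ i =>
      have := ih i
      simp [lookupT]; omega

lemma Trie.findT_cost_le (t : Trie α) (k : List Bool) : (t.findT k).cost ≤ k.length + 1 := by
  induction k generalizing t with
  | nil => cases t <;> simp [Trie.findT]
  | cons b k ih =>
    cases t with
    | empty => simp [Trie.findT]
    | node v z o =>
      have h1 := ih z
      have h2 := ih o
      cases b <;> simp [Trie.findT] <;> omega

lemma Trie.insertT_cost_le (a : α) (t : Trie α) (k : List Bool) :
    (t.insertT a k).cost ≤ k.length + 1 := by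
  induction k generalizing t with
  | nil => cases t <;> simp [Trie.insertT]
  | cons b k ih =>
    have h0 := ih .empty
    cases t with
    | empty => cases b <;> simp [Trie.insertT] <;> omega
    | node v z o =>
      have h1 := ih z
      have h2 := ih o
      cases b <;> simp [Trie.insertT] <;> omega

@[simp] lemma Trie.findT_empty (k : List Bool) : (Trie.empty : Trie α).findT k = ⟨none, 1⟩ := by
  cases k <;> simp [Trie.findT] <;> rfl

lemma Trie.findT_insertT (a : α) (t : Trie α) (k k' : List Bool) :
    ((t.insertT a k).val.findT k').val = if k' = k then some a else (t.findT k').val := by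
  induction k generalizing t k' with
  | nil => cases t <;> cases k' <;> simp [Trie.insertT, Trie.findT]
  | cons b k ih =>
    cases t with
    | empty =>
      cases k' with
      | nil => cases b <;> simp [Trie.insertT, Trie.findT]
      | cons b' k' => cases b <;> cases b' <;> simp [Trie.insertT, Trie.findT, ih]
    | node v z o =>
      cases k' with
      | nil => cases b <;> simp [Trie.insertT, Trie.findT]
      | cons b' k' => cases b <;> cases b' <;> simp [Trie.insertT, Trie.findT, ih]

end Programs

/-! ### Monomials -/

section Monomials

variable {n : ℕ}

lemma mem_monosT {k : ℕ} {l : List (Fin n)} (hl : l.Pairwise (· < ·)) {m : Mono n} :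
    m ∈ (monosT k l).val ↔ m.length = k ∧ m.Pairwise (· ≤ ·) ∧ ∀ x ∈ m, x ∈ l := by
  induction k, l using monosT.induct generalizing m with
  | case1 l =>
    simp only [monosT, Timed.bind_val, Timed.pure_val, List.mem_singleton, List.length_eq_zero_iff]
    exact ⟨by rintro rfl; simp, fun h => h.1⟩
  | case2 k =>
    simp only [monosT, Timed.bind_val, Timed.pure_val, List.not_mem_nil, false_iff]
    rintro ⟨h1, -, h2⟩
    cases m with
    | nil => simp at h1
    | cons x m => exact h2 x (by simp)
  | case3 k x xs ih1 ih2 =>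
    have hx := List.pairwise_cons.1 hl
    simp only [monosT, Timed.bind_val, appendT_val, mapT_val, Timed.pure_val, List.mem_append,
      List.mem_map, ih1 hl, ih2 hx.2]
    constructor
    · rintro (⟨m, ⟨h1, h2, h3⟩, rfl⟩ | ⟨h1, h2, h3⟩)
      · refine ⟨by simp [h1], List.pairwise_cons.2 ⟨fun y hy => ?_, h2⟩, ?_⟩
        · rcases List.mem_cons.1 (h3 y hy) with rfl | h
          · exact le_rfl
          · exact (hx.1 y h).le
        · intro y hy
          rcases List.mem_cons.1 hy with rfl | h
          · simp
          · exact h3 y h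
      · exact ⟨h1, h2, fun y hy => List.mem_cons_of_mem _ (h3 y hy)⟩
    · rintro ⟨h1, h2, h3⟩
      cases m with
      | nil => simp at h1
      | cons y m =>
        have hy := List.pairwise_cons.1 h2
        rcases List.mem_cons.1 (h3 y (by simp)) with rfl | h
        · exact Or.inl ⟨m, ⟨by simpa using h1, hy.2,
            fun z hz => h3 z (List.mem_cons_of_mem _ hz)⟩, rfl⟩
        · refine Or.inr ⟨h1, h2, fun z hz => ?_⟩
          have hyz : y ≤ z := by
            rcases List.mem_cons.1 hz with rfl | hz
            · exact le_rfl
            · exact hy.1 z hz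
          rcases List.mem_cons.1 (h3 z hz) with rfl | h'
          · exact absurd hyz (hx.1 y h).not_ge
          · exact h'

lemma mem_allMonosT {d : ℕ} {l : List (Fin n)} (hl : l.Pairwise (· < ·)) {m : Mono n} :
    m ∈ (allMonosT l d).val ↔
      1 ≤ m.length ∧ m.length ≤ d ∧ m.Pairwise (· ≤ ·) ∧ ∀ x ∈ m, x ∈ l := by
  induction d with
  | zero =>
    simp only [allMonosT, Timed.bind_val, Timed.pure_val, List.not_mem_nil, false_iff]
    omega
  | succ d ih =>
    simp only [allMonosT, Timed.bind_val, appendT_val, List.mem_append, ih, mem_monosT hl]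
    constructor
    · rintro (⟨h1, h2, h3⟩ | ⟨h1, h3⟩)
      · exact ⟨h1, by omega, h3⟩
      · exact ⟨by omega, by omega, h3⟩
    · rintro ⟨h1, h2, h3⟩
      rcases Nat.lt_or_ge d m.length with h | h
      · exact Or.inr ⟨by omega, h3⟩
      · exact Or.inl ⟨h1, h, h3⟩

lemma length_monosT_le (k : ℕ) (l : List (Fin n)) :
    (monosT k l).val.length ≤ (l.length + 1) ^ k := by
  induction k, l using monosT.induct with
  | case1 l => simp [monosT]
  | case2 k => simp [monosT]
  | case3 k x xs ih1 ih2 =>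
    simp only [monosT, Timed.bind_val, appendT_val, mapT_val, Timed.pure_val, List.length_append,
      List.length_map, List.length_cons] at *
    calc _ ≤ (xs.length + 1 + 1) ^ k + (xs.length + 1) ^ k * (xs.length + 1) := by
          rw [← pow_succ]; omega
      _ ≤ (xs.length + 1 + 1) ^ k + (xs.length + 1 + 1) ^ k * (xs.length + 1) := by
          gcongr; omega
      _ = _ := by rw [Nat.succ_eq_add_one]; ring

lemma cost_monosT_le (k : ℕ) (l : List (Fin n)) :
    (monosT k l).cost ≤ (6 * k + 1) * (l.length + 1) ^ k := by
  induction k, l using monosT.induct with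
  | case1 l => simp [monosT]
  | case2 k => simp [monosT]
  | case3 k x xs ih1 ih2 =>
    have h1 := length_monosT_le k (x :: xs)
    simp only [monosT, Timed.bind_cost, appendT_cost, tick_cost, mapT_val,
      Timed.pure_val, List.length_map, mapT_pure_cost, List.length_cons] at *
    have h2 : 1 ≤ (xs.length + 1 + 1) ^ k := Nat.one_le_pow _ _ (by omega)
    -- Two traversals of the first list and three single steps add at most five times the power to
    -- its own cost.
    calc _ ≤ (6 * k + 6) * (xs.length + 1 + 1) ^ k +
          (6 * (k + 1) + 1) * ((xs.length + 1) ^ k * (xs.length + 1)) := by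
          rw [← pow_succ]
          linarith
      _ ≤ (6 * (k + 1) + 1) * (xs.length + 1 + 1) ^ k +
          (6 * (k + 1) + 1) * ((xs.length + 1 + 1) ^ k * (xs.length + 1)) := by
          exact Nat.add_le_add (Nat.mul_le_mul_right _ (by omega))
            (Nat.mul_le_mul_left _ (Nat.mul_le_mul_right _ (Nat.pow_le_pow_left (by omega) k)))
      _ = _ := by rw [Nat.succ_eq_add_one]; ring

lemma length_allMonosT_le (d : ℕ) (l : List (Fin n)) :
    (allMonosT l d).val.length ≤ d * (l.length + 1) ^ d := by
  induction d with
  | zero => simp [allMonosT]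
  | succ d ih =>
    have h1 := length_monosT_le (d + 1) l
    have h2 : (l.length + 1) ^ d ≤ (l.length + 1) ^ (d + 1) :=
      Nat.pow_le_pow_right (by omega) (by omega)
    have h3 := Nat.mul_le_mul_left d h2
    simp only [allMonosT, Timed.bind_val, appendT_val, List.length_append]
    linarith

lemma cost_allMonosT_le (d : ℕ) (l : List (Fin n)) :
    (allMonosT l d).cost ≤ (d + 1) * (7 * d + 3) * (l.length + 1) ^ d := by
  induction d with
  | zero => simp [allMonosT]
  | succ d ih =>
    have h1 := cost_monosT_le (d + 1) l
    have h2 : (l.length + 1) ^ d ≤ (l.length + 1) ^ (d + 1) :=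
      Nat.pow_le_pow_right (by omega) (by omega)
    have h3 := Nat.mul_le_mul_left ((d + 1) * (7 * d + 3)) h2
    have h4 := length_allMonosT_le d l
    have h5 := Nat.mul_le_mul_left d h2
    have h6 : 1 ≤ (l.length + 1) ^ (d + 1) := Nat.one_le_pow _ _ (by omega)
    simp only [allMonosT, Timed.bind_cost, appendT_cost, tick_cost]
    nlinarith

lemma degCompareT_val (a b : Mono n) : (degCompareT a b).val = compare a.length b.length := by
  induction a, b using degCompareT.induct with
  | case1 => simp [degCompareT]
  | case2 => simp [degCompareT, eq_comm (a := Ordering.lt), compare_lt_iff_lt]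
  | case3 => simp [degCompareT, eq_comm (a := Ordering.gt), compare_gt_iff_gt]
  | case4 x a y b ih =>
    simp only [degCompareT, Timed.bind_val, ih, List.length_cons]
    simp [Nat.compare_eq_ite_lt]

lemma degCompareT_cost_le (a b : Mono n) : (degCompareT a b).cost ≤ a.length + 1 := by
  induction a, b using degCompareT.induct with
  | case1 => simp [degCompareT]
  | case2 => simp [degCompareT]
  | case3 => simp [degCompareT]
  | case4 x a y b ih => simp [degCompareT]; omega

lemma lexLessT_cost_le (a b : Mono n) : (lexLessT a b).cost ≤ a.length + 1 := by
  induction a generalizing b with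
  | nil => simp [lexLessT]
  | cons x a ih =>
    cases b with
    | nil => simp [lexLessT]
    | cons y b =>
      have := ih b
      simp only [lexLessT, Timed.bind_cost, tick_cost, List.length_cons]
      split
      · omega
      · simp only [Timed.pure_cost]; omega

lemma grlexLessT_cost_le (a b : Mono n) : (grlexLessT a b).cost ≤ 2 * a.length + 2 := by
  have h1 := degCompareT_cost_le a b
  have h2 := lexLessT_cost_le a b
  simp only [grlexLessT, Timed.bind_cost]
  split <;> (try simp only [Timed.pure_cost]) <;> omega

lemma smallestT_cost_le {d : ℕ} (m : Mono n) (l : List (Mono n)) (h : ∀ a ∈ l, a.length ≤ d) :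
    (smallestT m l).cost ≤ l.length * (2 * d + 3) + 1 := by
  induction l generalizing m with
  | nil => simp [smallestT]
  | cons a l ih =>
    have h1 := grlexLessT_cost_le a m
    have h2 := h a (by simp)
    have h3 := fun m => ih m fun b hb => h b (by simp [hb])
    simp only [smallestT, Timed.bind_cost, tick_cost, List.length_cons]
    split
    · have := h3 a; linarith
    · have := h3 m; linarith

lemma equalT_val (a b : Mono n) : (equalT a b).val = decide (a = b) := by
  induction a generalizing b with
  | nil => cases b <;> simp [equalT]
  | cons x a ih =>
    cases b with
    | nil => simp [equalT]
    | cons y b =>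
      simp only [equalT, Timed.bind_val]
      split <;> simp [*]

lemma equalT_cost_le (a b : Mono n) : (equalT a b).cost ≤ a.length + 1 := by
  induction a generalizing b with
  | nil => cases b <;> simp [equalT]
  | cons x a ih =>
    cases b with
    | nil => simp [equalT]
    | cons y b =>
      have := ih b
      simp only [equalT, Timed.bind_cost, tick_cost, List.length_cons]
      split
      · omega
      · simp

lemma dividesT_val (a b : Mono n) : (dividesT a b).val = decide (a.Sublist b) := by
  induction b generalizing a with
  | nil => cases a <;> simp [dividesT]
  | cons y b ih =>
    cases a with
    | nil => simp [dividesT]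
    | cons x a =>
      simp only [dividesT, Timed.bind_val]
      split
      · subst x; simp [ih]
      · rename_i h
        rw [ih]
        congr 1
        rw [List.sublist_cons_iff]
        simp [h]

lemma dividesT_cost_le (a b : Mono n) : (dividesT a b).cost ≤ b.length + 1 := by
  induction b generalizing a with
  | nil => cases a <;> simp [dividesT]
  | cons y b ih =>
    cases a with
    | nil => simp [dividesT]
    | cons x a =>
      have h1 := ih a
      have h2 := ih (x :: a)
      simp only [dividesT, Timed.bind_cost, tick_cost, List.length_cons]
      split <;> omega

end Monomials

/-! ### Boolean functions and combinations -/

@[simp] lemma xorBitsT_val (a b : List Bool) : (xorBitsT a b).val = List.zipWith xor a b := by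
  induction a generalizing b with
  | nil => simp [xorBitsT]
  | cons x a ih => cases b <;> simp [xorBitsT, ih]

lemma xorBitsT_cost_le (a b : List Bool) : (xorBitsT a b).cost ≤ a.length + 1 := by
  induction a generalizing b with
  | nil => simp [xorBitsT]
  | cons x a ih =>
    cases b with
    | nil => simp [xorBitsT]
    | cons y b =>
      have := ih b
      simp [xorBitsT]; omega

lemma BoolFn.xorT_cost_le (f g : BoolFn) : (f.xorT g).cost ≤ f.bits.length + 1 :=
  xorBitsT_cost_le _ _

lemma length_expandT_lt (fs : List BoolFn) : (expandT fs).val.length + 1 = 2 ^ fs.length := by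
  induction fs with
  | nil => simp [expandT]
  | cons f fs ih =>
    simp only [expandT, Timed.bind_val, appendT_val, mapT_val, List.length_append, List.length_map,
      List.length_cons, List.length_nil, pow_succ, ← ih]
    omega

lemma expandT_cost_le {n : ℕ} {fs : List BoolFn} (h : ∀ f ∈ fs, f.bits.length = n) :
    (expandT fs).cost ≤ 2 ^ fs.length * (n + 8) := by
  induction fs with
  | nil => simp [expandT]
  | cons f fs ih =>
    have h1 := ih fun g hg => h g (by simp [hg])
    have h2 := length_expandT_lt fs
    have h3 : ∀ p : ℚ × BoolFn, (do let g ← f.xorT p.2; return (-p.1, g) : Timed _).cost ≤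
        n + 1 := by
      intro p
      simpa [h f (by simp)] using f.xorT_cost_le p.2
    have h4 := mapT_cost_le (l := (expandT fs).val) fun p _ => h3 p
    simp only [expandT, Timed.bind_cost, tick_cost, appendT_cost, Timed.bind_val, mapT_val,
      List.length_map, List.length_cons, pow_succ, ← h2] at *
    nlinarith

lemma scaleT_val {n : ℕ} (q : Mono n) : (scaleT q).val = (1 / 2) ^ (q.length - 1) := by
  induction q using scaleT.induct with
  | case1 => simp [scaleT]
  | case2 => simp [scaleT]
  | case3 x y l ih =>
    simp only [scaleT, Timed.bind_val, ih, Timed.pure_val, List.length_cons, Nat.add_sub_cancel,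
      pow_succ]
    ring

lemma scaleT_cost_le {n : ℕ} (q : Mono n) : (scaleT q).cost ≤ q.length + 1 := by
  induction q using scaleT.induct with
  | case1 => simp [scaleT]
  | case2 => simp [scaleT]
  | case3 x y l ih => simp [scaleT] at *; omega

lemma CElem.substT_cost_le (c : CElem) (t : Bool) :
    (c.substT t).cost ≤ 3 * c.coeffs.length + 4 := by
  simp only [CElem.substT, Timed.bind_cost, mapT_pure_cost, appendT_cost, mapT_val, List.length_map,
    Timed.pure_val, appendT_val]
  split
  · simp only [Timed.pure_cost]; omega
  · simp only [Timed.bind_cost, mapT_pure_cost, List.length_append, List.length_map,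
      List.length_singleton]
    split <;> simp only [Timed.pure_cost] <;> omega

lemma addScaledT_cost_le (k : ℚ) (v w : List ℚ) : (addScaledT k v w).cost ≤ v.length + 1 := by
  induction v generalizing w with
  | nil => simp [addScaledT]
  | cons a v ih =>
    cases w with
    | nil => simp [addScaledT]
    | cons x w =>
      have := ih w
      simp [addScaledT]; omega

@[simp] lemma length_addScaledT (k : ℚ) (v w : List ℚ) :
    (addScaledT k v w).val.length = v.length := by
  induction v generalizing w with
  | nil => simp [addScaledT]
  | cons a v ih => cases w <;> simp [addScaledT, ih]

/-- The accumulator keeps its length, so the same bound serves every term. -/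
lemma combineT_cost_le {C : Trie CElem} {L N : ℕ}
    (hC : ∀ k c, (C.findT k).val = some c → c.coeffs.length ≤ L)
    (h : ℚ) (ts : List (ℚ × BoolFn)) (acc : List ℚ) (hts : ∀ p ∈ ts, p.2.bits.length = N) :
    (combineT C h ts acc).cost ≤ ts.length * (N + 3 * L + acc.length + 7) + 1 := by
  induction ts generalizing acc with
  | nil => simp [combineT]
  | cons p ts ih =>
    obtain ⟨s, f⟩ := p
    have h1 := C.findT_cost_le f.bits
    have h0 := hts (s, f) (by simp)
    simp only at h0
    simp only [combineT, Timed.bind_cost, tick_cost, List.length_cons]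
    split
    · simp only [Timed.pure_cost]; nlinarith
    · rename_i c hc
      have h2 := c.substT_cost_le f.const
      have h3 := hC _ _ hc
      have h4 := addScaledT_cost_le (s * h) acc (c.substT f.const).val
      have h5 := ih (addScaledT (s * h) acc (c.substT f.const).val).val
        fun p hp => hts p (by simp [hp])
      rw [length_addScaledT] at h5
      simp only [Timed.bind_cost]
      linarith

lemma length_of_combineT_eq_some {C : Trie CElem} {h : ℚ} {ts : List (ℚ × BoolFn)}
    {acc acc' : List ℚ} (he : (combineT C h ts acc).val = some acc') :
    acc'.length = acc.length := by
  induction ts generalizing acc with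
  | nil =>
    obtain rfl : acc = acc' := by simpa [combineT] using he
    rfl
  | cons p ts ih =>
    obtain ⟨s, f⟩ := p
    simp only [combineT, Timed.bind_val] at he
    split at he
    · simp at he
    · rw [ih he, length_addScaledT]

end LexToGrlex

namespace LexToGrlex

/-! ### Lists of variables as exponents -/

namespace Mono

variable {n : ℕ}

/-- The exponent vector of a monomial. -/
noncomputable def expo (a : Mono n) : Fin n →₀ ℕ := (a.map fun i => Finsupp.single i 1).sum

@[simp] lemma expo_nil : expo ([] : Mono n) = 0 := rfl

@[simp] lemma expo_cons (x : Fin n) (a : Mono n) :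
    expo (x :: a) = Finsupp.single x 1 + expo a := by
  simp [expo]

lemma expo_apply (a : Mono n) (i : Fin n) : expo a i = a.count i := by
  induction a with
  | nil => simp
  | cons x a ih =>
    rw [expo_cons, Finsupp.add_apply, ih, List.count_cons, Finsupp.single_apply, add_comm]
    simp

lemma degree_expo (a : Mono n) : (expo a).degree = a.length := by
  induction a with
  | nil => simp
  | cons x a ih => rw [expo_cons, map_add, ih, Finsupp.degree_single, List.length_cons, add_comm]

/-- For sorted lists inclusion of multisets is the same as being a sublist, which is why the greedy
test `dividesT` decides divisibility. -/
lemma sublist_iff {a b : Mono n} (ha : a.Pairwise (· ≤ ·)) (hb : b.Pairwise (· ≤ ·)) :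
    a.Sublist b ↔ expo a ≤ expo b := by
  constructor
  · intro h i
    rw [expo_apply, expo_apply]
    exact h.count_le i
  · intro h
    refine List.sublist_of_subperm_of_pairwise ?_ ha hb
    rw [List.subperm_ext_iff]
    intro i _
    simpa only [expo_apply] using h i

lemma expo_injective {a b : Mono n} (ha : a.Pairwise (· ≤ ·)) (hb : b.Pairwise (· ≤ ·))
    (h : expo a = expo b) : a = b :=
  ((sublist_iff ha hb).2 h.le).antisymm ((sublist_iff hb ha).2 h.ge)

lemma exists_expo_eq (e : Fin n →₀ ℕ) : ∃ a : Mono n, a.Pairwise (· ≤ ·) ∧ expo a = e := by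
  refine ⟨(Finsupp.toMultiset e).sort (· ≤ ·), Multiset.pairwise_sort _ _, ?_⟩
  ext i
  rw [expo_apply, ← Multiset.coe_count, Multiset.sort_eq, Finsupp.count_toMultiset]

open MvPolynomial in
lemma prod_X (a : Mono n) : (a.map X).prod = (monomial (expo a) 1 : MvPolynomial (Fin n) ℝ) := by
  induction a with
  | nil => simp
  | cons x a ih => rw [List.map_cons, List.prod_cons, ih, expo_cons, X, monomial_mul, one_mul]

lemma lexLessT_val {a b : Mono n} (ha : a.Pairwise (· ≤ ·)) (hb : b.Pairwise (· ≤ ·))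
    (hl : a.length = b.length) :
    (lexLessT a b).val = true ↔ toLex (expo a) < toLex (expo b) := by
  -- The head of a sorted list is its largest variable: both exponents vanish before `y`, and at `y`
  -- only the second is positive.
  have key : ∀ {x y : Fin n} {a b : Mono n}, (x :: a).Pairwise (· ≤ ·) →
      (y :: b).Pairwise (· ≤ ·) → y < x →
      toLex (expo (x :: a)) < toLex (expo (y :: b)) := by
    intro x y a b ha hb hyx
    have h0 : ∀ {z j : Fin n} {c : Mono n}, (z :: c).Pairwise (· ≤ ·) → j < z →
        expo (z :: c) j = 0 := by
      intro z j c hc hj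
      rw [expo_apply, List.count_eq_zero]
      intro hmem
      rcases List.mem_cons.1 hmem with rfl | h
      · exact lt_irrefl _ hj
      · exact ((List.pairwise_cons.1 hc).1 j h).not_gt hj
    rw [Finsupp.Lex.lt_iff]
    refine ⟨y, fun j hj => ?_, ?_⟩
    · show expo (x :: a) j = expo (y :: b) j
      rw [h0 ha (hj.trans hyx), h0 hb hj]
    · show expo (x :: a) y < expo (y :: b) y
      rw [h0 ha hyx, expo_apply]
      simp
  induction a generalizing b with
  | nil =>
    have : b = [] := List.length_eq_zero_iff.1 hl.symm
    subst this
    simp [lexLessT]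
  | cons x a ih =>
    match b, hl with
    | y :: b, hl =>
      simp only [lexLessT, Timed.bind_val]
      split
      · subst x
        have hl' : a.length = b.length := by simpa using hl
        refine (ih ha.of_cons hb.of_cons hl').trans ?_
        rw [expo_cons, expo_cons, toLex_add,
          toLex_add, add_lt_add_iff_left]
      · rename_i hne
        simp only [Timed.pure_val, decide_eq_true_eq]
        constructor
        · exact key ha hb
        · intro h
          by_contra h'
          exact lt_asymm h (key hb ha (lt_of_le_of_ne (not_lt.1 h') hne))

open scoped MonomialOrder

lemma expo_lt_expo_iff {a b : Mono n} : expo a ≺[MonomialOrder.degLex] expo b ↔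
    a.length < b.length ∨ a.length = b.length ∧ toLex (expo a) < toLex (expo b) := by
  rw [MonomialOrder.degLex_lt_iff, Finsupp.DegLex.lt_iff]
  simp [degree_expo]

lemma degLex_lt_of_length_lt {a b : Mono n} (h : a.length < b.length) :
    expo a ≺[MonomialOrder.degLex] expo b :=
  expo_lt_expo_iff.2 (Or.inl h)

lemma grlexLessT_val {a b : Mono n} (ha : a.Pairwise (· ≤ ·)) (hb : b.Pairwise (· ≤ ·)) :
    (grlexLessT a b).val = true ↔ expo a ≺[MonomialOrder.degLex] expo b := by
  simp only [grlexLessT, Timed.bind_val, degCompareT_val, expo_lt_expo_iff]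
  split <;> rename_i h
  · rw [compare_lt_iff_lt] at h
    simp [h]
  · rw [compare_gt_iff_gt] at h
    simp only [Timed.pure_val, Bool.false_eq_true, false_iff]
    rintro (h1 | ⟨h1, -⟩) <;> omega
  · rw [compare_eq_iff_eq] at h
    simp [lexLessT_val ha hb h, h]

lemma smallestT_mem (m : Mono n) (l : List (Mono n)) : (smallestT m l).val ∈ m :: l := by
  induction l generalizing m with
  | nil => simp [smallestT]
  | cons a l ih =>
    simp only [smallestT, Timed.bind_val]
    split
    · exact List.mem_cons_of_mem _ (ih a)
    · have := ih m
      simp only [List.mem_cons] at *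
      tauto

lemma smallestT_le {m : Mono n} {l : List (Mono n)} (h : ∀ a ∈ m :: l, a.Pairwise (· ≤ ·))
    {b : Mono n} (hb : b ∈ m :: l) :
    expo (smallestT m l).val ≼[MonomialOrder.degLex] expo b := by
  induction l generalizing m b with
  | nil =>
    rw [List.mem_singleton.1 hb]
    simp [smallestT]
  | cons a l ih =>
    have hm := h m (by simp)
    have ha := h a (by simp)
    have h1 : ∀ c ∈ a :: l, c.Pairwise (· ≤ ·) := fun c hc => h c (List.mem_cons_of_mem _ hc)
    have h2 : ∀ c ∈ m :: l, c.Pairwise (· ≤ ·) := fun c hc => h c (by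
      simp only [List.mem_cons] at *; tauto)
    simp only [smallestT, Timed.bind_val]
    split <;> rename_i hlt
    · rw [grlexLessT_val ha hm] at hlt
      rcases List.mem_cons.1 hb with rfl | hb
      · exact (ih h1 (by simp)).trans hlt.le
      · exact ih h1 hb
    · rw [grlexLessT_val ha hm, not_lt] at hlt
      rcases List.mem_cons.1 hb with rfl | hb
      · exact ih h2 (by simp)
      · rcases List.mem_cons.1 hb with rfl | hb
        · exact (ih h2 (by simp)).trans hlt
        · exact ih h2 (List.mem_cons_of_mem _ hb)

end Mono

end LexToGrlex

namespace LexToGrlex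

/-! ### Values of linear combinations -/

/-- The linear combination of the entries of a list with the given coefficients. -/
noncomputable def lin : List ℚ → List ℝ → ℝ
  | a :: v, x :: w => a * x + lin v w
  | _, _ => 0

@[simp] lemma lin_nil_left (w : List ℝ) : lin [] w = 0 := by simp [lin]

@[simp] lemma lin_nil_right (v : List ℚ) : lin v [] = 0 := by cases v <;> simp [lin]

lemma lin_map_mul (k : ℚ) (v : List ℚ) (w : List ℝ) :
    lin (v.map fun a => k * a) w = k * lin v w := by
  induction v generalizing w with
  | nil => simp
  | cons a v ih =>
    cases w with
    | nil => simp
    | cons x w => simp only [List.map_cons, lin, ih]; push_cast; ring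

lemma lin_append_singleton (v : List ℚ) (c : ℚ) {w : List ℝ} (h : v.length < w.length) :
    lin (v ++ [c]) w = lin v w + c * w[v.length] := by
  induction v generalizing w with
  | nil =>
    cases w with
    | nil => simp at h
    | cons x w => simp [lin]
  | cons a v ih =>
    cases w with
    | nil => simp at h
    | cons x w => simp [lin, ih (by simpa using h)]; ring

lemma lin_append_right {v : List ℚ} {w : List ℝ} (h : v.length ≤ w.length) (w' : List ℝ) :
    lin v (w ++ w') = lin v w := by
  induction v generalizing w with
  | nil => simp
  | cons a v ih =>
    cases w with
    | nil => simp at h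
    | cons x w => simp [lin, ih (by simpa using h)]

/-- The bound on the length is essential, as `addScaledT` drops the entries of `v` beyond the end of
`acc`. -/
lemma lin_addScaledT (k : ℚ) {acc v : List ℚ} {w : List ℝ} (h : v.length ≤ acc.length) :
    lin (addScaledT k acc v).val w = lin acc w + k * lin v w := by
  induction acc generalizing v w with
  | nil =>
    have : v = [] := List.length_eq_zero_iff.1 (Nat.le_zero.1 h)
    subst this
    simp [addScaledT]
  | cons a acc ih =>
    cases v with
    | nil => simp [addScaledT]
    | cons x v =>
      cases w with
      | nil => simp
      | cons z w =>
        simp only [addScaledT, Timed.bind_val, Timed.pure_val, lin, ih (by simpa using h)]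
        push_cast
        ring

lemma lin_replicate_zero (k : ℕ) (w : List ℝ) : lin (List.replicate k 0) w = 0 := by
  induction k generalizing w with
  | zero => simp
  | succ k ih => cases w <;> simp [List.replicate_succ, lin, ih]

/-- The element `c` represents the entry at the position given by the number of its coefficients. -/
def CElem.Represents (c : CElem) (key : List Bool) (w : List ℝ) (y : ℕ → ℤˣ) : Prop :=
  c.lead ≠ 0 ∧ ∃ h : c.coeffs.length < w.length,
    w[c.coeffs.length] = lin c.coeffs w + c.lead * BoolFn.value ⟨key, c.const⟩ y

lemma BoolFn.value_not (key : List Bool) (s t : Bool) (h : t ≠ s) (y : ℕ → ℤˣ) :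
    BoolFn.value ⟨key, t⟩ y = 1 - BoolFn.value ⟨key, s⟩ y := by
  cases s <;> cases t <;> simp [BoolFn.value, bitSign] at h ⊢ <;> ring

lemma CElem.length_substT (c : CElem) (t : Bool) :
    (c.substT t).val.length = c.coeffs.length + 1 := by
  simp only [CElem.substT, Timed.bind_val, mapT_val, appendT_val, Timed.pure_val]
  split
  · simp
  · cases c.coeffs <;> simp

/-- The stored identity is solved for the Boolean term, which is possible as `lead ≠ 0`. For the
opposite constant, `1 - F` is formed in the first coefficient, because the first value is that of
`b_1 = 1`. -/
lemma CElem.lin_substT {c : CElem} {key : List Bool} {w : List ℝ} {y : ℕ → ℤˣ}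
    (hc : c.Represents key w y) (hw : w.head? = some 1) (t : Bool) :
    lin (c.substT t).val w = BoolFn.value ⟨key, t⟩ y := by
  obtain ⟨h0, hlt, he⟩ := hc
  have h0' : (c.lead : ℝ) ≠ 0 := by exact_mod_cast h0
  have h1 : lin (c.coeffs.map (fun a => -a / c.lead) ++ [1 / c.lead]) w =
      BoolFn.value ⟨key, c.const⟩ y := by
    rw [lin_append_singleton _ _ (by simpa using hlt)]
    simp only [List.length_map]
    rw [he, show (fun a : ℚ => -a / c.lead) = fun a => (-1 / c.lead) * a by ext a; ring,
      lin_map_mul]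
    push_cast
    field_simp
    ring
  obtain ⟨w', rfl⟩ : ∃ w', w = 1 :: w' := by
    cases w with
    | nil => simp at hw
    | cons x w => exact ⟨w, by simpa using hw⟩
  have h2 := lin_map_mul (-1) (c.coeffs.map (fun a => -a / c.lead) ++ [1 / c.lead]) (1 :: w')
  rw [h1] at h2
  simp only [CElem.substT, Timed.bind_val, mapT_val, appendT_val, Timed.pure_val]
  split
  · rename_i h
    rw [h, Timed.pure_val, h1]
  · rename_i h
    rw [BoolFn.value_not key _ _ h]
    simp only [neg_one_mul] at h2
    simp only [Timed.bind_val, mapT_val, Timed.pure_val]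
    generalize hu : List.map (fun a => -a) (c.coeffs.map (fun a => -a / c.lead) ++ [1 / c.lead]) = u
    rw [hu] at h2
    cases u with
    | nil => simp at hu
    | cons a u =>
      simp only [lin, Timed.pure_val] at h2 ⊢
      push_cast at h2 ⊢
      linear_combination h2

/-- The value of a signed sum of Boolean terms. -/
noncomputable def termSum (ts : List (ℚ × BoolFn)) (y : ℕ → ℤˣ) : ℝ :=
  (ts.map fun p => (p.1 : ℝ) * p.2.value y).sum

/-- The coefficients are uniform in `y`: only the values `w` depend on the point, so one combination
represents the whole function. -/
lemma exists_combineT {C : Trie CElem} {h : ℚ} {ts : List (ℚ × BoolFn)} {acc : List ℚ}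
    {w : (ℕ → ℤˣ) → List ℝ} (hw : ∀ y, (w y).head? = some 1)
    (hC : ∀ p ∈ ts, ∃ c, (C.findT p.2.bits).val = some c ∧
      ∀ y, c.Represents p.2.bits (w y) y) (hacc : ∀ y, acc.length = (w y).length) :
    ∃ acc', (combineT C h ts acc).val = some acc' ∧ acc'.length = acc.length ∧
      ∀ y, lin acc' (w y) = lin acc (w y) + h * termSum ts y := by
  induction ts generalizing acc with
  | nil => exact ⟨acc, by simp [combineT], rfl, by simp [termSum]⟩
  | cons p ts ih =>
    obtain ⟨s, f⟩ := p
    obtain ⟨c, hc, hr⟩ := hC (s, f) (by simp)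
    simp only at hc hr
    have hlen := c.length_substT f.const
    have hlt : ∀ y, c.coeffs.length < (w y).length := fun y => (hr y).2.1
    obtain ⟨acc', h1, h2, h3⟩ := ih (acc := (addScaledT (s * h) acc (c.substT f.const).val).val)
      (fun p hp => hC p (by simp [hp])) (by simpa using hacc)
    refine ⟨acc', ?_, by simpa using h2, fun y => ?_⟩
    · simp only [combineT, Timed.bind_val, hc]
      exact h1
    · rw [h3, lin_addScaledT _ (by rw [hlen, hacc y]; exact hlt y),
        CElem.lin_substT (hr y) (hw y)]
      simp only [termSum, List.map_cons, List.sum_cons]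
      push_cast
      ring

/-! ### The expansion into Boolean terms -/

/-- A sign occurring in both factors squares to one; equal lengths keep `zipWith` from truncating.
-/
lemma chi_zipWith_xor (k : ℕ) {a b : List Bool} (h : a.length = b.length) :
    chi k (List.zipWith xor a b) = chi k a * chi k b := by
  induction a generalizing k b with
  | nil =>
    have : b = [] := List.length_eq_zero_iff.1 h.symm
    subst this
    simp [chi]
  | cons x a ih =>
    match b, h with
    | z :: b, h =>
      rw [List.zipWith_cons_cons, chi, chi, chi, ih _ (by simpa using h), mul_mul_mul_comm]
      congr 1
      cases x <;> cases z <;> simp [signHom_mul_self]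

lemma BoolFn.value_mul {f g : BoolFn} (h : f.bits.length = g.bits.length) (y : ℕ → ℤˣ) :
    (f.xorT g).val.value y = f.value y + g.value y - 2 * (f.value y * g.value y) := by
  simp only [BoolFn.value, BoolFn.xorT, Timed.bind_val, Timed.pure_val, xorBitsT_val, bitSign_xor,
    chi_zipWith_xor 0 h, MonoidHom.mul_apply]
  ring

lemma expandT_cons_val (f : BoolFn) (fs : List BoolFn) :
    (expandT (f :: fs)).val = (expandT fs).val.map (fun p => (-p.1, (f.xorT p.2).val)) ++
      ((expandT fs).val ++ [(1, f)]) := by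
  simp only [expandT, Timed.bind_val, appendT_val, mapT_val, Timed.pure_val]

lemma length_bits_expandT {n : ℕ} {fs : List BoolFn} (h : ∀ f ∈ fs, f.bits.length = n) :
    ∀ p ∈ (expandT fs).val, p.2.bits.length = n := by
  induction fs with
  | nil => simp [expandT]
  | cons f fs ih =>
    have h1 := ih fun g hg => h g (by simp [hg])
    have h0 := h f (by simp)
    intro p hp
    simp only [expandT, Timed.bind_val, appendT_val, mapT_val, List.mem_append, List.mem_map,
      List.mem_singleton, Timed.pure_val] at hp
    rcases hp with ⟨p', hp', rfl⟩ | hp | rfl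
    · simp [BoolFn.xorT, h0, h1 p' hp']
    · exact h1 p hp
    · exact h0

/-- The terms with and without `f` cancel in pairs, except for `f` alone. The sum is the coefficient
of `f` in `termSum_map_xor`. -/
lemma expandT_sum_sign {f : BoolFn} {fs : List BoolFn} :
    ((expandT (f :: fs)).val.map Prod.fst).sum = 1 := by
  simp only [expandT, Timed.bind_val, appendT_val, mapT_val, List.map_append, List.map_map,
    Timed.pure_val, List.sum_append]
  have : ∀ l : List (ℚ × BoolFn), (l.map (Prod.fst ∘ fun p => (-p.1, (f.xorT p.2).val))).sum =
      -(l.map Prod.fst).sum := by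
    intro l
    induction l with
    | nil => simp
    | cons p l ih => simp only [List.map_cons, List.sum_cons, ih, Function.comp_apply]; ring
  rw [this]
  simp

lemma termSum_append (k l : List (ℚ × BoolFn)) (y : ℕ → ℤˣ) :
    termSum (k ++ l) y = termSum k y + termSum l y := by
  simp [termSum]

lemma termSum_map_xor {n : ℕ} {f : BoolFn} (hf : f.bits.length = n) {ts : List (ℚ × BoolFn)}
    (h : ∀ p ∈ ts, p.2.bits.length = n) (y : ℕ → ℤˣ) :
    termSum (ts.map fun p => (-p.1, (f.xorT p.2).val)) y =
      2 * f.value y * termSum ts y - termSum ts y - f.value y * (ts.map Prod.fst).sum := by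
  induction ts with
  | nil => simp [termSum]
  | cons p ts ih =>
    have h1 := ih fun p hp => h p (by simp [hp])
    simp only [termSum, List.map_cons, List.sum_cons] at h1 ⊢
    rw [h1, BoolFn.value_mul (by rw [hf, h p (by simp)])]
    push_cast
    ring

/-- Let `Σ` be the signed sum for the remaining functions. By `f ⊕ g = f + g - 2fg` the terms with
`f` and others give `2fΣ - Σ - f`; adding `Σ` and the single term `f` leaves `2fΣ`, whence one
factor `1/2` per step. -/
lemma prod_value_eq {n : ℕ} {f : BoolFn} {fs : List BoolFn}
    (h : ∀ g ∈ f :: fs, g.bits.length = n) (y : ℕ → ℤˣ) :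
    ((f :: fs).map fun g => g.value y).prod =
      (1 / 2) ^ fs.length * termSum (expandT (f :: fs)).val y := by
  induction fs generalizing f with
  | nil => simp [expandT, termSum]
  | cons g fs ih =>
    have hfs : ∀ k ∈ g :: fs, k.bits.length = n := fun k hk => h k (by simp at hk ⊢; tauto)
    have h1 := ih hfs
    rw [List.map_cons, List.prod_cons, h1, expandT_cons_val f (g :: fs), termSum_append,
      termSum_append, termSum_map_xor (h f (by simp)) (length_bits_expandT hfs), expandT_sum_sign]
    simp only [termSum, List.map_cons, List.map_nil, List.sum_cons, List.sum_nil, List.length_cons]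
    push_cast
    ring

end LexToGrlex

namespace LexToGrlex

open MvPolynomial
open scoped MonomialOrder

lemma CElem.Represents.append {c : CElem} {k : List Bool} {w : List ℝ} {y : ℕ → ℤˣ}
    (h : c.Represents k w y) (w' : List ℝ) : c.Represents k (w ++ w') y := by
  obtain ⟨h0, hlt, he⟩ := h
  refine ⟨h0, by rw [List.length_append]; omega, ?_⟩
  rw [List.getElem_append_left hlt, lin_append_right hlt.le, he]

/-! ### Output polynomials -/

namespace OutPoly

variable {n : ℕ}

lemma toPoly_cons (p : ℚ × Mono n) (g : OutPoly n) :
    toPoly (p :: g) = monomial p.2.expo (p.1 : ℝ) + toPoly g := by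
  rw [toPoly, List.map_cons, List.sum_cons, Mono.prod_X, C_mul_monomial, mul_one, toPoly]

lemma toPoly_zip_neg (k : List ℚ) (B : List (Mono n)) :
    toPoly ((k.map fun a => -a).zip B) = -toPoly (k.zip B) := by
  induction k generalizing B with
  | nil => simp [toPoly]
  | cons a k ih =>
    cases B with
    | nil => simp [toPoly]
    | cons b B =>
      rw [List.map_cons, List.zip_cons_cons, List.zip_cons_cons, toPoly_cons, toPoly_cons, ih]
      simp only [Rat.cast_neg, map_neg]
      ring

lemma mem_support_toPoly_zip {k : List ℚ} {B : List (Mono n)} {e : Fin n →₀ ℕ}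
    (he : e ∈ (toPoly (k.zip B)).support) : ∃ b ∈ B, e = b.expo := by
  classical
  induction k generalizing B with
  | nil => simp [toPoly] at he
  | cons a k ih =>
    cases B with
    | nil => simp [toPoly] at he
    | cons b B =>
      rw [List.zip_cons_cons, toPoly_cons] at he
      rcases Finset.mem_union.1 (support_add he) with h | h
      · exact ⟨b, by simp, Finset.mem_singleton.1 (support_monomial_subset h)⟩
      · obtain ⟨b', hb', rfl⟩ := ih h
        exact ⟨b', by simp [hb'], rfl⟩

end OutPoly

/-! ### Keys of monomials and the span of their characters -/

namespace RrefSystem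

variable {n : ℕ} (S : RrefSystem n)

/-- The value of a monomial at the solution given by `y`. -/
noncomputable def monoValue (a : Mono n) (y : ℕ → ℤˣ) : ℝ := (a.map (S.point y)).prod

/-- The bits of the longest Boolean term of a monomial. -/
def key (a : Mono n) : List Bool :=
  a.foldr (fun i k => List.zipWith xor (S.fn i).bits k) (List.replicate n false)

lemma eval_monomial_expo (a : Mono n) (c : ℝ) (y : ℕ → ℤˣ) :
    eval (S.point y) (monomial a.expo c) = c * S.monoValue a y := by
  rw [← mul_one c, ← C_mul_monomial, ← Mono.prod_X, map_mul, eval_C, mul_one, map_list_prod,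
    List.map_map, monoValue]
  congr 2
  ext i
  simp

lemma eval_toPoly_zip (k : List ℚ) (B : List (Mono n)) (y : ℕ → ℤˣ) :
    eval (S.point y) (OutPoly.toPoly (k.zip B)) = lin k (B.map (S.monoValue · y)) := by
  induction k generalizing B with
  | nil => simp [OutPoly.toPoly]
  | cons a k ih =>
    cases B with
    | nil => simp [OutPoly.toPoly]
    | cons b B =>
      rw [List.zip_cons_cons, OutPoly.toPoly_cons, map_add, ih, eval_monomial_expo, List.map_cons,
        lin]

@[simp] lemma length_key (a : Mono n) : (S.key a).length = n := by
  induction a with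
  | nil => simp [key]
  | cons i a ih =>
    rw [key, List.foldr_cons, ← key, List.length_zipWith, ih, S.length_fn_bits, min_self]

lemma key_cons (i : Fin n) (a : Mono n) :
    S.key (i :: a) = List.zipWith xor (S.fn i).bits (S.key a) := rfl

lemma zipWith_xor_replicate_false (l : List Bool) :
    List.zipWith xor l (List.replicate l.length false) = l := by
  induction l with
  | nil => rfl
  | cons a l ih => simp [List.replicate_succ, ih]

lemma key_singleton (i : Fin n) : S.key [i] = (S.fn i).bits := by
  have := zipWith_xor_replicate_false (S.fn i).bits
  rwa [S.length_fn_bits] at this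

lemma chi_key_nil : chi 0 (S.key []) = 1 := by
  have : ∀ k m, chi k (List.replicate m false) = 1 := by
    intro k m
    induction m generalizing k with
    | zero => rfl
    | succ m ih => simp [List.replicate_succ, chi, ih]
  exact this 0 n

/-- Each Boolean term belongs to a nonempty sublist of factors, and the full list stays in front.
Thus all terms except the first have keys of proper divisors. -/
lemma exists_expandT (q : Mono n) (hq : q ≠ []) :
    ∃ σ F rest, (expandT (q.map S.fn)).val = (σ, F) :: rest ∧ σ ≠ 0 ∧ F.bits = S.key q ∧
      ∀ p ∈ rest, ∃ T : Mono n, T.Sublist q ∧ T ≠ q ∧ p.2.bits = S.key T := by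
  induction q with
  | nil => exact absurd rfl hq
  | cons i q ih =>
    rw [List.map_cons, expandT_cons_val]
    by_cases h : q = []
    · subst h
      exact ⟨1, S.fn i, [], rfl, one_ne_zero, (S.key_singleton i).symm, by simp⟩
    · obtain ⟨σ, F, rest, he, h0, hF, hr⟩ := ih h
      rw [he]
      refine ⟨-σ, ((S.fn i).xorT F).val, _, rfl, neg_ne_zero.2 h0, ?_, ?_⟩
      · rw [key_cons, ← hF]; simp [BoolFn.xorT]
      · intro p hp
        have hne : ∀ {T : Mono n}, T.Sublist q → T ≠ i :: q := by
          rintro T hT rfl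
          simpa using hT.length_le
        replace hp : p ∈ rest.map (fun p => (-p.1, ((S.fn i).xorT p.2).val)) ++
          ((σ, F) :: rest ++ [(1, S.fn i)]) := hp
        rw [List.mem_append, List.mem_append, List.mem_cons, List.mem_singleton] at hp
        rcases hp with hp | (rfl | hp) | rfl
        · obtain ⟨p', hp', rfl⟩ := List.mem_map.1 hp
          obtain ⟨T, hT, hne', hb⟩ := hr p' hp'
          refine ⟨i :: T, hT.cons_cons i, by simpa using hne', ?_⟩
          rw [key_cons, ← hb]; simp [BoolFn.xorT]
        · exact ⟨q, List.sublist_cons_self i q, hne (List.Sublist.refl q), hF⟩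
        · obtain ⟨T, hT, hne', hb⟩ := hr p hp
          exact ⟨T, hT.cons i, hne hT, hb⟩
        · refine ⟨[i], (List.nil_sublist q).cons_cons i, ?_, (S.key_singleton i).symm⟩
          intro h'
          exact h (List.cons.inj h').2.symm

lemma monoValue_eq {q : Mono n} (hq : q ≠ []) (y : ℕ → ℤˣ) :
    S.monoValue q y = (scaleT q).val * termSum (expandT (q.map S.fn)).val y := by
  cases q with
  | nil => exact absurd rfl hq
  | cons i q =>
    have h := prod_value_eq (n := n) (f := S.fn i) (fs := q.map S.fn) (fun g hg => by
      rw [← List.map_cons] at hg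
      obtain ⟨j, -, rfl⟩ := List.mem_map.1 hg
      exact S.length_fn_bits j) y
    rw [← List.map_cons, List.map_map, List.length_map] at h
    rw [scaleT_val, List.length_cons, Nat.add_sub_cancel]
    push_cast
    exact h

lemma map_lookupT_fns (q : Mono n) :
    (mapT (fun i : Fin n => lookupT ⟨[], false⟩ S.fns i.val) q).val = q.map S.fn := by
  rw [mapT_val]
  refine List.map_congr_left fun i _ => ?_
  rw [lookupT_val, fns_eq, List.getD_eq_getElem _ _ (by simp)]
  simp

/-- The span of the characters that belong to the longest Boolean terms of the given monomials. -/
noncomputable def keySpan (B : List (Mono n)) : Submodule ℝ ((ℕ → ℤˣ) → ℝ) :=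
  Submodule.span ℝ ((fun k => (chi 0 k : (ℕ → ℤˣ) → ℝ)) '' {k | ∃ b ∈ B, k = S.key b})

lemma chi_key_mem_keySpan {B : List (Mono n)} {b : Mono n} (hb : b ∈ B) :
    (chi 0 (S.key b) : (ℕ → ℤˣ) → ℝ) ∈ S.keySpan B :=
  Submodule.subset_span ⟨_, ⟨b, hb, rfl⟩, rfl⟩

lemma keySpan_mono {B B' : List (Mono n)} (h : B ⊆ B') : S.keySpan B ≤ S.keySpan B' :=
  Submodule.span_mono (Set.image_mono fun _ ⟨b, hb, hk⟩ => ⟨b, h hb, hk⟩)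

/-- The value is affine in the character of `b`; the constant part is the trivial character, which
is the key of the empty monomial. -/
lemma value_mem_keySpan {B : List (Mono n)} (h0 : [] ∈ B) {f : BoolFn} {b : Mono n} (hb : b ∈ B)
    (hf : f.bits = S.key b) : f.value ∈ S.keySpan B := by
  have h1 := S.chi_key_mem_keySpan h0
  rw [chi_key_nil] at h1
  have h2 := S.chi_key_mem_keySpan hb
  have : f.value = (1 / 2 : ℝ) • ((1 : (ℕ → ℤˣ) →* ℝ) : (ℕ → ℤˣ) → ℝ) +
      (-(bitSign f.const) / 2) • (chi 0 (S.key b) : (ℕ → ℤˣ) → ℝ) := by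
    ext y
    simp only [BoolFn.value, hf, Pi.add_apply, Pi.smul_apply, MonoidHom.one_apply, smul_eq_mul]
    ring
  rw [this]
  exact Submodule.add_mem _ (Submodule.smul_mem _ _ h1) (Submodule.smul_mem _ _ h2)

lemma termSum_mem_keySpan {B : List (Mono n)} (h0 : [] ∈ B) {ts : List (ℚ × BoolFn)}
    (h : ∀ p ∈ ts, ∃ b ∈ B, p.2.bits = S.key b) : termSum ts ∈ S.keySpan B := by
  induction ts with
  | nil =>
    have : termSum [] = 0 := by ext y; simp [termSum]
    rw [this]
    exact Submodule.zero_mem _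
  | cons p ts ih =>
    obtain ⟨b, hb, hk⟩ := h p (by simp)
    have : termSum (p :: ts) = (p.1 : ℝ) • p.2.value + termSum ts := by
      ext y; simp [termSum]
    rw [this]
    exact Submodule.add_mem _ (Submodule.smul_mem _ _ (S.value_mem_keySpan h0 hb hk))
      (ih fun p hp => h p (by simp [hp]))

/-- Dedekind's independence of characters: a character in the span of a set of characters belongs to
the set. All keys have length `n`, so equal characters mean equal keys. -/
lemma exists_key_eq_of_mem_keySpan {B : List (Mono n)} {q : Mono n}
    (h : (chi 0 (S.key q) : (ℕ → ℤˣ) → ℝ) ∈ S.keySpan B) : ∃ b ∈ B, S.key q = S.key b := by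
  have hli := linearIndependent_monoidHom (ℕ → ℤˣ) ℝ
  have himg : (fun k => (chi 0 k : (ℕ → ℤˣ) → ℝ)) '' {k | ∃ b ∈ B, k = S.key b} =
      (fun f : (ℕ → ℤˣ) →* ℝ => (f : (ℕ → ℤˣ) → ℝ)) '' (chi 0 '' {k | ∃ b ∈ B, k = S.key b}) := by
    rw [Set.image_image]
  rw [keySpan, himg] at h
  by_contra hne
  refine hli.notMem_span_image (x := chi 0 (S.key q)) ?_ h
  rintro ⟨k, ⟨b, hb, rfl⟩, hk⟩
  exact hne ⟨b, hb, (chi_injective (by simp) hk).symm⟩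

end RrefSystem

end LexToGrlex

namespace LexToGrlex

open MvPolynomial
open scoped MonomialOrder

variable {n : ℕ}

/-! ### The loop invariant -/

/-- The loop invariant of the conversion algorithm; `N` bounds the number of monomials. -/
structure Invariant (S : RrefSystem n) (d N : ℕ) (s : State n) : Prop where
  sorted : ∀ a ∈ s.Q, a.Pairwise (· ≤ ·)
  length_pos : ∀ a ∈ s.Q, a ≠ []
  length_le : ∀ a ∈ s.Q, a.length ≤ d
  cover : ∀ a : Mono n, a.Pairwise (· ≤ ·) → a.length ≤ d → a ∈ s.Q ∨ a ∈ s.B ∨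
    ∃ g ∈ s.G₂, MonomialOrder.degLex.degree (OutPoly.toPoly g) ≤ a.expo
  basis : ∀ g ∈ s.G₂,
    OutPoly.toPoly g ∈ truncate d (reducedBasis MonomialOrder.degLex (Ideal.span S.G₁))
  avoid : ∀ a ∈ s.Q, ∀ g ∈ s.G₂, ¬ MonomialOrder.degLex.degree (OutPoly.toPoly g) ≤ a.expo
  standard : ∀ b ∈ s.B, b.expo ∉ initialExps MonomialOrder.degLex (Ideal.span S.G₁)
  below : ∀ b ∈ s.B, ∀ a ∈ s.Q, b.expo ≺[MonomialOrder.degLex] a.expo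
  head : s.B.head? = some []
  found : ∀ b ∈ s.B, ∃ c, (s.C.findT (S.key b)).val = some c
  represents : ∀ k c, (s.C.findT k).val = some c → (∃ b ∈ s.B, k = S.key b) ∧
    ∀ y, c.Represents k (s.B.map (S.monoValue · y)) y
  mem_span : ∀ b ∈ s.B, S.monoValue b ∈ S.keySpan s.B
  card : s.B.length + s.Q.length ≤ N + 1

namespace Invariant

variable {S : RrefSystem n} {d N : ℕ} {s : State n}

lemma nil_mem (h : Invariant S d N s) : [] ∈ s.B := List.mem_of_mem_head? h.head

lemma head_values (h : Invariant S d N s) (y : ℕ → ℤˣ) :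
    (s.B.map (S.monoValue · y)).head? = some 1 := by
  rw [List.head?_map, h.head]
  simp [RrefSystem.monoValue]

/-- Every proper divisor of the smallest remaining monomial is in `B`. -/
lemma mem_of_sublist (h : Invariant S d N s) {q : Mono n} (hq : q ∈ s.Q)
    (hmin : ∀ a ∈ s.Q, q.expo ≼[MonomialOrder.degLex] a.expo) {T : Mono n} (hT : T.Sublist q)
    (hne : T ≠ q) : T ∈ s.B := by
  have hs := (h.sorted q hq).sublist hT
  have hlt : T.length < q.length :=
    lt_of_le_of_ne hT.length_le fun he => hne (hT.eq_of_length he)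
  -- `T` has too small a degree to remain in `Q`, and an output leading monomial dividing `T` would
  -- divide `q`.
  rcases h.cover T hs (hlt.le.trans (h.length_le q hq)) with h1 | h1 | ⟨g, hg, h1⟩
  · exact absurd (Mono.degLex_lt_of_length_lt hlt) (hmin T h1).not_gt
  · exact h1
  · exact absurd (h1.trans ((Mono.sublist_iff hs (h.sorted q hq)).1 hT)) (h.avoid q hq g hg)

/-- The standard monomials that are smaller than the smallest remaining one are in `B`. -/
lemma mem_of_standard (h : Invariant S d N s) {q : Mono n} (hq : q ∈ s.Q)
    (hmin : ∀ a ∈ s.Q, q.expo ≼[MonomialOrder.degLex] a.expo) {a : Mono n}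
    (ha : a.Pairwise (· ≤ ·)) (hlt : a.expo ≺[MonomialOrder.degLex] q.expo)
    (hstd : a.expo ∉ initialExps MonomialOrder.degLex (Ideal.span S.G₁)) : a ∈ s.B := by
  have hlen : a.length ≤ q.length := by
    rcases Mono.expo_lt_expo_iff.1 hlt with h1 | h1 <;> omega
  rcases h.cover a ha (hlen.trans (h.length_le q hq)) with h1 | h1 | ⟨g, hg, h1⟩
  · exact absurd hlt (hmin a h1).not_gt
  · exact h1
  · exact absurd (initialExps_mono (degree_mem_of_mem_reducedBasis (h.basis g hg).1) h1) hstd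

/-- If the longest Boolean term of `q` is new, then `q` is a standard monomial. -/
lemma standard_of_new (h : Invariant S d N s) {q : Mono n} (hq : q ∈ s.Q)
    (hmin : ∀ a ∈ s.Q, q.expo ≼[MonomialOrder.degLex] a.expo)
    {h₀ σ : ℚ} (hh : h₀ ≠ 0) (hσ : σ ≠ 0) {F : BoolFn} (hF : F.bits = S.key q)
    {g : (ℕ → ℤˣ) → ℝ} (hg : g ∈ S.keySpan s.B)
    (hval : ∀ y, S.monoValue q y = h₀ * (σ * F.value y + g y))
    (hnew : (s.C.findT F.bits).val = none) :
    q.expo ∉ initialExps MonomialOrder.degLex (Ideal.span S.G₁) := by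
  intro hmem
  -- The monomials of `r` are standard and smaller than `q`, hence in `B`, so the value of `q` would
  -- lie in the span of the keys of `B`.
  obtain ⟨r, hr, hr'⟩ := exists_reduction hmem
  have h1 : S.monoValue q ∈ S.keySpan s.B := by
    have he : S.monoValue q = ∑ e ∈ r.support,
        r.coeff e • S.monoValue (Classical.choose (Mono.exists_expo_eq e)) := by
      ext y
      have h2 := (S.mem_span_G₁_iff _).1 hr y
      rw [map_sub, S.eval_monomial_expo, one_mul, sub_eq_zero] at h2
      rw [h2, Finset.sum_apply]
      conv_lhs => rw [r.as_sum, map_sum]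
      refine Finset.sum_congr rfl fun e _ => ?_
      have h3 := (Classical.choose_spec (Mono.exists_expo_eq e)).2
      conv_lhs => rw [← h3]
      rw [S.eval_monomial_expo, Pi.smul_apply, smul_eq_mul, h3]
    rw [he]
    refine Submodule.sum_mem _ fun e he => Submodule.smul_mem _ _ (h.mem_span _ ?_)
    obtain ⟨h3, h4⟩ := Classical.choose_spec (Mono.exists_expo_eq e)
    exact h.mem_of_standard hq hmin h3 (by rw [h4]; exact (hr' e he).2)
      (by rw [h4]; exact (hr' e he).1)
  have h2 : (chi 0 (S.key q) : (ℕ → ℤˣ) → ℝ) ∈ S.keySpan s.B := by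
    have h3 := S.chi_key_mem_keySpan h.nil_mem
    rw [S.chi_key_nil] at h3
    have h0 : (h₀ : ℝ) ≠ 0 := by exact_mod_cast hh
    have h0' : (σ : ℝ) ≠ 0 := by exact_mod_cast hσ
    -- `hval` is solved for `F`, and then `F = (1 - s χ) / 2` for `χ`, using `s² = 1`.
    have he : (chi 0 (S.key q) : (ℕ → ℤˣ) → ℝ) =
        bitSign F.const • (((1 : (ℕ → ℤˣ) →* ℝ) : (ℕ → ℤˣ) → ℝ) -
          (2 / (σ : ℝ)) • ((1 / (h₀ : ℝ)) • S.monoValue q - g)) := by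
      ext y
      simp only [Pi.smul_apply, Pi.sub_apply, MonoidHom.one_apply, smul_eq_mul, hval y,
        BoolFn.value, hF]
      field_simp
      linear_combination (-(σ : ℝ) * chi 0 (S.key q) y) * bitSign_mul_self F.const
    rw [he]
    exact Submodule.smul_mem _ _ (Submodule.sub_mem _ h3 (Submodule.smul_mem _ _
      (Submodule.sub_mem _ (Submodule.smul_mem _ _ h1) hg)))
  obtain ⟨b, hb, hk⟩ := S.exists_key_eq_of_mem_keySpan h2
  obtain ⟨c, hc⟩ := h.found b hb
  rw [hF, hk, hc] at hnew
  exact Option.some_ne_none c hnew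

/-- The invariant is preserved when a standard monomial is appended to `B`. -/
lemma insert (h : Invariant S d N s) {q : Mono n} (hq : q ∈ s.Q)
    (hmin : ∀ a ∈ s.Q, q.expo ≼[MonomialOrder.degLex] a.expo)
    {c : CElem} (hlead : c.lead ≠ 0) (hlen : c.coeffs.length = s.B.length)
    {g : (ℕ → ℤˣ) → ℝ} (hg : g ∈ S.keySpan s.B)
    (hlin : ∀ y, lin c.coeffs (s.B.map (S.monoValue · y)) = g y)
    (hval : ∀ y, S.monoValue q y = g y + c.lead * BoolFn.value ⟨S.key q, c.const⟩ y)
    (hstd : q.expo ∉ initialExps MonomialOrder.degLex (Ideal.span S.G₁)) :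
    Invariant S d N ⟨s.G₂, s.B ++ [q], (s.C.insertT c (S.key q)).val,
      s.Q.filter fun a => !decide (q = a)⟩ := by
  have hsub : s.B ⊆ s.B ++ [q] := List.subset_append_left _ _
  have hQ : ∀ a ∈ s.Q.filter (fun a => !decide (q = a)), a ∈ s.Q ∧ q ≠ a := fun a ha => by
    simpa using List.mem_filter.1 ha
  constructor
  · exact fun a ha => h.sorted a (hQ a ha).1
  · exact fun a ha => h.length_pos a (hQ a ha).1
  · exact fun a ha => h.length_le a (hQ a ha).1
  · intro a ha hal
    by_cases he : q = a
    · exact Or.inr (Or.inl (by simp [he]))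
    · rcases h.cover a ha hal with h1 | h1 | h1
      · exact Or.inl (List.mem_filter.2 ⟨h1, by simpa using he⟩)
      · exact Or.inr (Or.inl (hsub h1))
      · exact Or.inr (Or.inr h1)
  · exact h.basis
  · exact fun a ha => h.avoid a (hQ a ha).1
  · intro b hb
    rcases List.mem_append.1 hb with hb | hb
    · exact h.standard b hb
    · rwa [List.mem_singleton.1 hb]
  · intro b hb a ha
    obtain ⟨ha, hne⟩ := hQ a ha
    rcases List.mem_append.1 hb with hb | hb
    · exact h.below b hb a ha
    · rw [List.mem_singleton.1 hb]
      refine lt_of_le_of_ne (hmin a ha) fun he => hne ?_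
      exact Mono.expo_injective (h.sorted q hq) (h.sorted a ha)
        (MonomialOrder.degLex.toSyn.injective he)
  · rw [List.head?_append, h.head]; rfl
  · intro b hb
    rw [Trie.findT_insertT]
    split
    · exact ⟨c, rfl⟩
    · rename_i hne
      rcases List.mem_append.1 hb with hb | hb
      · exact h.found b hb
      · rw [List.mem_singleton.1 hb] at hne
        exact absurd rfl hne
  · intro k c' hc'
    rw [Trie.findT_insertT] at hc'
    split at hc'
    · rename_i hk
      obtain rfl := Option.some.inj hc'
      subst hk
      -- The number of coefficients is the old length of `B`, which is the position of `q` in the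
      -- new list.
      refine ⟨⟨q, by simp, rfl⟩, fun y => ⟨hlead, by simp [hlen], ?_⟩⟩
      simp only [List.map_append, List.map_cons, List.map_nil]
      rw [lin_append_right (by simp [hlen]), hlin, List.getElem_append_right (by simp [hlen])]
      simpa using hval y
    · obtain ⟨⟨b, hb, hk⟩, hr⟩ := h.represents k c' hc'
      refine ⟨⟨b, hsub hb, hk⟩, fun y => ?_⟩
      rw [List.map_append]
      exact (hr y).append _
  · intro b hb
    rcases List.mem_append.1 hb with hb | hb
    · exact S.keySpan_mono hsub (h.mem_span b hb)
    · have he : S.monoValue b = g + (c.lead : ℝ) • BoolFn.value ⟨S.key q, c.const⟩ := by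
        ext y
        rw [List.mem_singleton.1 hb, hval]
        rfl
      rw [he]
      exact Submodule.add_mem _ (S.keySpan_mono hsub hg) (Submodule.smul_mem _ _
        (S.value_mem_keySpan (hsub h.nil_mem) (b := q) (by simp) rfl))
  · have h1 := h.card
    have h2 : (s.Q.filter fun a => !decide (q = a)).length < s.Q.length :=
      List.length_filter_lt_length_iff_exists.2 ⟨q, hq, by simp⟩
    simp only [List.length_append, List.length_singleton]
    omega

/-- The invariant is preserved when a polynomial is added to the output. -/
lemma output (h : Invariant S d N s) {q : Mono n} (hq : q ∈ s.Q)
    (hmin : ∀ a ∈ s.Q, q.expo ≼[MonomialOrder.degLex] a.expo)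
    {k : List ℚ} (hk : ∀ y, S.monoValue q y = lin k (s.B.map (S.monoValue · y))) :
    Invariant S d N ⟨((1, q) :: (k.map fun a => -a).zip s.B) :: s.G₂, s.B, s.C,
      s.Q.filter fun a => !decide (q.Sublist a)⟩ := by
  have hQ : ∀ a ∈ s.Q.filter (fun a => !decide (q.Sublist a)), a ∈ s.Q ∧ ¬ q.Sublist a :=
    fun a ha => by simpa using List.mem_filter.1 ha
  have hp : OutPoly.toPoly ((1, q) :: (k.map fun a => -a).zip s.B) =
      monomial q.expo 1 - OutPoly.toPoly (k.zip s.B) := by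
    rw [OutPoly.toPoly_cons, OutPoly.toPoly_zip_neg, Rat.cast_one, sub_eq_add_neg]
  have hsupp : ∀ e ∈ (OutPoly.toPoly (k.zip s.B)).support,
      e ∉ initialExps MonomialOrder.degLex (Ideal.span S.G₁) ∧
        e ≺[MonomialOrder.degLex] q.expo := by
    intro e he
    obtain ⟨b, hb, rfl⟩ := OutPoly.mem_support_toPoly_zip he
    exact ⟨h.standard b hb, h.below b hb q hq⟩
  have hI : monomial q.expo 1 - OutPoly.toPoly (k.zip s.B) ∈ Ideal.span S.G₁ := by
    rw [S.mem_span_G₁_iff]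
    intro y
    rw [map_sub, S.eval_monomial_expo, S.eval_toPoly_zip, one_mul, hk, sub_self]
  obtain ⟨hdeg, -⟩ := degree_monomial_sub (m := MonomialOrder.degLex) fun e he => (hsupp e he).2
  -- Minimality of `q`: a proper divisor is in `B` and therefore standard.
  have hred := sub_mem_reducedBasis hI hsupp (by
    intro e he hle
    obtain ⟨T, hT, rfl⟩ := Mono.exists_expo_eq e
    by_contra hne
    exact h.standard T (h.mem_of_sublist hq hmin
      ((Mono.sublist_iff hT (h.sorted q hq)).2 hle) fun h' => hne (h' ▸ rfl)) he)
  constructor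
  · exact fun a ha => h.sorted a (hQ a ha).1
  · exact fun a ha => h.length_pos a (hQ a ha).1
  · exact fun a ha => h.length_le a (hQ a ha).1
  · intro a ha hal
    by_cases he : q.Sublist a
    · refine Or.inr (Or.inr ⟨_, List.mem_cons_self, ?_⟩)
      rw [hp, hdeg]
      exact (Mono.sublist_iff (h.sorted q hq) ha).1 he
    · rcases h.cover a ha hal with h1 | h1 | ⟨g, hg, h1⟩
      · exact Or.inl (List.mem_filter.2 ⟨h1, by simpa using he⟩)
      · exact Or.inr (Or.inl h1)
      · exact Or.inr (Or.inr ⟨g, List.mem_cons_of_mem _ hg, h1⟩)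
  · intro g hg
    rcases List.mem_cons.1 hg with rfl | hg
    · rw [hp]
      refine ⟨hred, ?_⟩
      rw [← degree_degLexDegree, hdeg, Mono.degree_expo]
      exact h.length_le q hq
    · exact h.basis g hg
  · intro a ha g hg
    rcases List.mem_cons.1 hg with rfl | hg
    · rw [hp, hdeg, ← Mono.sublist_iff (h.sorted q hq) (h.sorted a (hQ a ha).1)]
      exact (hQ a ha).2
    · exact h.avoid a (hQ a ha).1 g hg
  · exact h.standard
  · exact fun b hb a ha => h.below b hb a (hQ a ha).1
  · exact h.head
  · exact h.found
  · exact h.represents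
  · exact h.mem_span
  · exact (Nat.add_le_add_left (List.length_filter_le _ _) _).trans h.card

/-- If monomials remain, then the loop continues and the invariant is preserved. -/
theorem exists_next (h : Invariant S d N s) (hQ : s.Q ≠ []) :
    ∃ s', (bodyT S.fns s).val = .next s' ∧ Invariant S d N s' ∧ s'.Q.length < s.Q.length := by
  obtain ⟨m, ms, hms⟩ := List.exists_cons_of_ne_nil hQ
  obtain ⟨q, hqdef⟩ : ∃ q, q = (smallestT m ms).val := ⟨_, rfl⟩
  have hq : q ∈ s.Q := by
    rw [hms, hqdef]
    exact Mono.smallestT_mem m ms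
  have hmin : ∀ a ∈ s.Q, q.expo ≼[MonomialOrder.degLex] a.expo := by
    intro a ha
    rw [hms] at ha
    rw [hqdef]
    exact Mono.smallestT_le (fun a ha => h.sorted a (by rwa [hms])) ha
  have hq0 := h.length_pos q hq
  obtain ⟨σ, F, rest, hts, hσ, hF, hrest⟩ := S.exists_expandT q hq0
  have hterms : ∀ p ∈ rest, ∃ b ∈ s.B, p.2.bits = S.key b := fun p hp => by
    obtain ⟨T, hT, hne, hb⟩ := hrest p hp
    exact ⟨T, h.mem_of_sublist hq hmin hT hne, hb⟩
  have hscale : (scaleT q).val ≠ 0 := by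
    rw [scaleT_val]
    positivity
  have hval : ∀ y, S.monoValue q y = (scaleT q).val * (σ * F.value y + termSum rest y) := by
    intro y
    rw [S.monoValue_eq hq0, hts]
    simp [termSum]
  -- The accumulator starts with one zero for each element of `B`, so no substituted combination is
  -- cut off.
  obtain ⟨acc, hacc, hlen, hlin⟩ := exists_combineT (C := s.C) (h := (scaleT q).val) (ts := rest)
    (acc := List.replicate s.B.length 0) (w := fun y => s.B.map (S.monoValue · y))
    h.head_values (fun p hp => by
      obtain ⟨b, hb, hk⟩ := hterms p hp
      obtain ⟨c, hc⟩ := h.found b hb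
      rw [← hk] at hc
      exact ⟨c, hc, (h.represents _ c hc).2⟩) (fun y => by simp)
  rw [List.length_replicate] at hlen
  simp only [lin_replicate_zero, zero_add] at hlin
  have hspan := S.termSum_mem_keySpan h.nil_mem hterms
  have hzero : (s.B.map fun _ => (0 : ℚ)) = List.replicate s.B.length 0 := by simp
  cases hfind : (s.C.findT F.bits).val with
  | none =>
    refine ⟨⟨s.G₂, s.B ++ [q], (s.C.insertT ⟨acc, σ * (scaleT q).val, F.const⟩ (S.key q)).val,
      s.Q.filter fun a => !decide (q = a)⟩, ?_, ?_, ?_⟩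
    · rw [← hF]
      simp only [bodyT, hms, Timed.bind_val, ← hqdef, S.map_lookupT_fns, hts, mapT_val,
        Timed.pure_val, hzero, hacc, hfind, appendT_val, deleteT_val, equalT_val]
    · refine h.insert hq hmin (mul_ne_zero hσ hscale) hlen (Submodule.smul_mem _
        ((scaleT q).val : ℝ) hspan) (fun y => hlin y) (fun y => ?_)
        (h.standard_of_new hq hmin hscale hσ hF hspan hval hfind)
      rw [hval, ← hF]
      simp only [Pi.smul_apply, smul_eq_mul]
      push_cast
      ring
    · exact List.length_filter_lt_length_iff_exists.2 ⟨q, hq, by simp⟩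
  | some c =>
    have hr := (h.represents _ c hfind).2
    refine ⟨⟨((1, q) :: ((addScaledT (σ * (scaleT q).val) acc
      (c.substT F.const).val).val.map fun a => -a).zip s.B) :: s.G₂, s.B, s.C,
      s.Q.filter fun a => !decide (q.Sublist a)⟩, ?_, ?_, ?_⟩
    · simp only [bodyT, hms, Timed.bind_val, ← hqdef, S.map_lookupT_fns, hts, mapT_val,
        Timed.pure_val, hzero, hacc, hfind, zipT_val, deleteT_val, dividesT_val]
    · refine h.output hq hmin fun y => ?_
      rw [lin_addScaledT, hlin, CElem.lin_substT (hr y) (h.head_values y), hval]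
      · push_cast
        ring
      · rw [CElem.length_substT, hlen]
        simpa using (hr y).2.1
    · exact List.length_filter_lt_length_iff_exists.2 ⟨q, hq, by simp⟩

end Invariant

end LexToGrlex

namespace LexToGrlex

open MvPolynomial
open scoped MonomialOrder

variable {n : ℕ}

/-! ### The running time of the loop -/

/-- A bound for the cost of one pass through the loop, if there are at most `N` monomials. -/
def passBound (d n N : ℕ) : ℕ := (20 * 2 ^ d + 10 * d + 40) * (n + (N + 1) + 1)

namespace Invariant

variable {S : RrefSystem n} {d N : ℕ} {s : State n}

/-- Selection and deletion in `Q` cost `O(dN)`, the expansion costs `O(2^d n)`, and each of fewer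
than `2^d` substitutions costs `O(n + N)`, since stored combinations are no longer than `B`. -/
lemma cost_bodyT_le (h : Invariant S d N s) : (bodyT S.fns s).cost ≤ passBound d n N := by
  have hB : s.B.length ≤ N + 1 := by have := h.card; omega
  have hQ : s.Q.length ≤ N + 1 := by have := h.card; omega
  have hC : ∀ k c, (s.C.findT k).val = some c → c.coeffs.length ≤ N + 1 := fun k c hc => by
    -- The point `1` is arbitrary: only the information on lengths is used.
    obtain ⟨-, hlt, -⟩ := (h.represents k c hc).2 1
    rw [List.length_map] at hlt
    omega
  have hP : 1 ≤ 2 ^ d := Nat.one_le_two_pow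
  simp only [bodyT, Timed.bind_cost, tick_cost]
  unfold passBound
  generalize N + 1 = L at *
  split
  · simp only [Timed.pure_cost]
    nlinarith [Nat.zero_le ((20 * 2 ^ d + 10 * d + 39) * (n + L + 1))]
  rename_i m ms hms
  obtain ⟨q, hqdef⟩ : ∃ q, q = (smallestT m ms).val := ⟨_, rfl⟩
  have hqQ : q ∈ s.Q := by
    rw [hms, hqdef]
    exact Mono.smallestT_mem m ms
  have hqd : q.length ≤ d := h.length_le q hqQ
  have hms' : ms.length ≤ L := by
    rw [hms, List.length_cons] at hQ
    omega
  have c1 := smallestT_cost_le (d := d) m ms fun a ha =>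
    h.length_le a (hms ▸ List.mem_cons_of_mem m ha)
  have c1' := Nat.mul_le_mul_right (2 * d + 3) hms'
  have c2 := mapT_cost_le (f := fun i : Fin n => lookupT ⟨[], false⟩ S.fns i.val) (l := q)
    (c := n + 1) fun i _ => (lookupT_cost_le _ _ _).trans (by simp [S.fns_eq])
  have c2' := Nat.mul_le_mul_right (n + 1 + 1) hqd
  have hbits : ∀ f ∈ q.map S.fn, f.bits.length = n := fun f hf => by
    obtain ⟨i, -, rfl⟩ := List.mem_map.1 hf
    exact S.length_fn_bits i
  have c3 := expandT_cost_le hbits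
  have hpow : 2 ^ (q.map S.fn).length ≤ 2 ^ d :=
    Nat.pow_le_pow_right (by omega) (by simpa using hqd)
  have c3' := Nat.mul_le_mul_right (n + 8) hpow
  have c4 := scaleT_cost_le q
  have c5 := mapT_pure_cost (fun _ => (0 : ℚ)) s.B
  have e1 : 0 ≤ d * L := Nat.zero_le _
  have e2 : 0 ≤ d * n := Nat.zero_le _
  have e3 : 0 ≤ 2 ^ d * n := Nat.zero_le _
  have e4 : 0 ≤ 2 ^ d * L := Nat.zero_le _
  simp only [← hqdef, S.map_lookupT_fns, Timed.bind_cost]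
  cases hts : (expandT (q.map S.fn)).val with
  | nil =>
    simp only [Timed.pure_cost]
    linarith
  | cons p rest =>
    obtain ⟨σ, F⟩ := p
    have hlen := length_expandT_lt (q.map S.fn)
    have hb := length_bits_expandT hbits
    rw [hts] at hlen hb
    rw [List.length_cons] at hlen
    have hF : F.bits.length = n := hb (σ, F) (by simp)
    have c6 := combineT_cost_le hC (scaleT q).val rest (s.B.map fun _ => (0 : ℚ))
      fun p hp => hb p (List.mem_cons_of_mem _ hp)
    rw [List.length_map] at c6
    have hrest : rest.length ≤ 2 ^ d := by omega
    have c6' := Nat.mul_le_mul hrest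
      (show n + 3 * L + s.B.length + 7 ≤ n + 4 * L + 7 by omega)
    simp only [Timed.bind_cost, mapT_val, Timed.pure_val]
    cases hacc : (combineT s.C (scaleT q).val rest (s.B.map fun _ => (0 : ℚ))).val with
    | none =>
      simp only [Timed.pure_cost]
      linarith
    | some acc =>
      have hacclen : acc.length ≤ L := by
        rw [length_of_combineT_eq_some hacc, List.length_map]
        exact hB
      have c7 := s.C.findT_cost_le F.bits
      rw [hF] at c7
      simp only [Timed.bind_cost]
      cases hfind : (s.C.findT F.bits).val with
      | none =>
        have c8 := s.C.insertT_cost_le ⟨acc, σ * (scaleT q).val, F.const⟩ F.bits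
        rw [hF] at c8
        have c9 := deleteT_cost_le (p := fun a => equalT q a) (l := s.Q) (c := d + 1)
          fun a _ => (equalT_cost_le q a).trans (by omega)
        have c9' := Nat.mul_le_mul_right (d + 1 + 1) hQ
        simp only [Timed.bind_cost, Timed.pure_cost, appendT_cost]
        linarith
      | some c =>
        have c8 := c.substT_cost_le F.const
        have c8' := hC _ _ hfind
        have c9 := deleteT_cost_le (p := fun a => dividesT q a) (l := s.Q) (c := d + 1)
          fun a ha => (dividesT_cost_le q a).trans (by have := h.length_le a ha; omega)
        have c9' := Nat.mul_le_mul_right (d + 1 + 1) hQ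
        have c10 := addScaledT_cost_le (σ * (scaleT q).val) acc (c.substT F.const).val
        have c11 := zipT_cost_le ((addScaledT (σ * (scaleT q).val) acc
          (c.substT F.const).val).val.map fun a => -a) s.B
        rw [List.length_map, length_addScaledT] at c11
        simp only [Timed.bind_cost, Timed.pure_cost, mapT_pure_cost, mapT_val,
          Timed.pure_val, length_addScaledT]
        linarith

/-- The loop terminates in a state without remaining monomials. -/
theorem exists_runs (h : Invariant S d N s) :
    ∃ t k, Runs S.fns s t k ∧ Invariant S d N t ∧ t.Q = [] ∧
      k ≤ (s.Q.length + 1) * passBound d n N := by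
  induction hl : s.Q.length using Nat.strong_induction_on generalizing s with
  | _ l ih =>
    by_cases hQ : s.Q = []
    · refine ⟨s, _, .halt s ?_, h, hQ, ?_⟩
      · simp [bodyT, hQ]
      -- The extra `1` in the bound pays for the last pass, which finds `Q` empty.
      · exact h.cost_bodyT_le.trans (Nat.le_mul_of_pos_left _ (Nat.succ_pos _))
    · obtain ⟨s', h1, h2, h3⟩ := h.exists_next hQ
      obtain ⟨t, k, h4, h5, h6, h7⟩ := ih _ (hl ▸ h3) h2 rfl
      refine ⟨t, _, .next s s' t k h1 h4, h5, h6, ?_⟩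
      have h8 := h.cost_bodyT_le
      have h9 := Nat.mul_le_mul_right (passBound d n N) (show s'.Q.length + 1 ≤ l by omega)
      linarith

/-- The output when no monomials remain. -/
theorem output_eq (h : Invariant S d N s) (hQ : s.Q = []) :
    s.output = truncate d (reducedBasis MonomialOrder.degLex (Ideal.span S.G₁)) := by
  apply Set.Subset.antisymm
  · rintro _ ⟨g, hg, rfl⟩
    exact h.basis g hg
  · rintro p ⟨hp, hpd⟩
    have hdeg := degree_mem_of_mem_reducedBasis hp
    obtain ⟨a, ha, he⟩ := Mono.exists_expo_eq (MonomialOrder.degLex.degree p)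
    have hal : a.length ≤ d := by
      rwa [← Mono.degree_expo, he, degree_degLexDegree]
    -- A leading monomial cannot be in `B`, so an output leading monomial divides it; minimality
    -- makes the two equal.
    rcases h.cover a ha hal with h1 | h1 | ⟨g, hg, h1⟩
    · simp [hQ] at h1
    · exact absurd (he ▸ hdeg) (h.standard a h1)
    · rw [he] at h1
      have hg' := (h.basis g hg).1
      exact ⟨g, hg, (eq_of_mem_reducedBasis hg' hp
        (hp.2.2.1 _ (degree_mem_of_mem_reducedBasis hg') h1)).symm⟩

end Invariant

/-- The system has a solution, for instance at `y = 1`, so no nonzero constant vanishes at all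
solutions. -/
lemma zero_notMem_initialExps (S : RrefSystem n) :
    (0 : Fin n →₀ ℕ) ∉ initialExps MonomialOrder.degLex (Ideal.span S.G₁) := by
  rintro ⟨p, hp, h0, hd⟩
  have h1 := MonomialOrder.eq_C_of_degree_eq_zero hd
  have h2 := (S.mem_span_G₁_iff p).1 hp 1
  rw [h1, eval_C] at h2
  exact h0 (MonomialOrder.degLex.leadingCoeff_eq_zero_iff.1 h2)

theorem invariant_initT (S : RrefSystem n) (d : ℕ) :
    Invariant S d (allMonosT (List.finRange n) d).val.length
      (initT d (List.finRange n)).val := by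
  have hfin : (List.finRange n).Pairwise (· < ·) := List.pairwise_lt_finRange n
  have hkey : (mapT (fun _ => pure false) (List.finRange n)).val = S.key [] := by
    simp [RrefSystem.key]
  have hval : ∀ y, S.monoValue [] y = 1 := fun y => rfl
  -- No variables and the constant `true` give the Boolean function `1`, which is `b_1` itself.
  have hrep : ∀ y, CElem.Represents ⟨[], 1, true⟩ (S.key []) [1] y := fun y => by
    refine ⟨one_ne_zero, by simp, ?_⟩
    simp [BoolFn.value, S.chi_key_nil, bitSign]
  simp only [initT, Timed.bind_val, Timed.pure_val, hkey]
  constructor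
  · exact fun a ha => ((mem_allMonosT hfin).1 ha).2.2.1
  · rintro a ha rfl
    simpa using ((mem_allMonosT hfin).1 ha).1
  · exact fun a ha => ((mem_allMonosT hfin).1 ha).2.1
  · intro a ha hal
    by_cases h0 : a = []
    · exact Or.inr (Or.inl (by simp [h0]))
    · exact Or.inl ((mem_allMonosT hfin).2 ⟨List.length_pos_iff.2 h0, hal, ha, by simp⟩)
  · simp
  · simp
  · intro b hb
    rw [List.mem_singleton.1 hb]
    exact zero_notMem_initialExps S
  · intro b hb a ha
    rw [List.mem_singleton.1 hb]
    exact Mono.degLex_lt_of_length_lt ((mem_allMonosT hfin).1 ha).1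
  · rfl
  · intro b hb
    rw [List.mem_singleton.1 hb, Trie.findT_insertT, if_pos rfl]
    exact ⟨_, rfl⟩
  · intro k c hc
    rw [Trie.findT_insertT] at hc
    split at hc
    · rename_i hk
      obtain rfl := Option.some.inj hc
      subst hk
      exact ⟨⟨[], by simp, rfl⟩, fun y => hrep y⟩
    · simp at hc
  · intro b hb
    rw [List.mem_singleton.1 hb]
    have h1 := S.chi_key_mem_keySpan (B := [[]]) (b := []) (by simp)
    rw [S.chi_key_nil] at h1
    exact h1
  · simp [add_comm]

lemma cost_initT_le (d n : ℕ) : (initT d (List.finRange n)).cost ≤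
    (d + 1) * (7 * d + 3) * (n + 1) ^ d + 2 * n + 2 := by
  have h1 := cost_allMonosT_le d (List.finRange n)
  have h2 := mapT_pure_cost (fun _ => false) (List.finRange n)
  have h3 := Trie.empty.insertT_cost_le (⟨[], 1, true⟩ : CElem)
    (mapT (fun _ => pure false) (List.finRange n)).val
  simp only [initT, Timed.bind_cost, Timed.pure_cost, mapT_val, List.length_map,
    List.length_finRange] at *
  omega

end LexToGrlex

/-! ### The total number of steps -/

theorem theorem2 (d : ℕ) (hd : 1 ≤ d) :
    ∃ K : ℕ, ∀ (n : ℕ), 1 ≤ n → ∀ S : LexToGrlex.RrefSystem n,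
      ∃ (t : LexToGrlex.State n) (k : ℕ),
        LexToGrlex.Terminates d S t k ∧
        k ≤ K * n ^ (2 * d) ∧
        ∃ G₂ : Set (MvPolynomial (Fin n) ℝ),
          LexToGrlex.IsReducedGroebnerBasis MonomialOrder.degLex (Ideal.span S.G₁) G₂ ∧
          t.output = LexToGrlex.truncate d G₂ := by
  -- With `E = n ^ d`: the list `Q` starts with `N ≤ A E` monomials, a pass costs at most `P (n + N
  -- + 2) ≤ P (A + 3) E`, and the initialisation costs at most `(D 2^d + 4) E`.
  obtain ⟨A, hA⟩ : ∃ A, A = d * 2 ^ d := ⟨_, rfl⟩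
  obtain ⟨P, hP⟩ : ∃ P, P = 20 * 2 ^ d + 10 * d + 40 := ⟨_, rfl⟩
  obtain ⟨D, hD⟩ : ∃ D, D = (d + 1) * (7 * d + 3) := ⟨_, rfl⟩
  refine ⟨D * 2 ^ d + 4 + (A + 1) * (P * (A + 3)), fun n hn S => ?_⟩
  have hinv := LexToGrlex.invariant_initT S d
  obtain ⟨t, k, hrun, ht, hQ, hk⟩ := hinv.exists_runs
  refine ⟨t, _, ⟨k, hrun, rfl⟩, ?_, _, LexToGrlex.isReducedGroebnerBasis_reducedBasis _ _,
    ht.output_eq hQ⟩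
  have hQ0 : (LexToGrlex.initT d (List.finRange n)).val.Q =
    (LexToGrlex.allMonosT (List.finRange n) d).val := rfl
  have hinit := LexToGrlex.cost_initT_le d n
  have hN := LexToGrlex.length_allMonosT_le d (List.finRange n)
  rw [hQ0] at hk
  rw [List.length_finRange] at hN
  rw [← hD] at hinit
  unfold LexToGrlex.passBound at hk
  rw [← hP] at hk
  generalize (LexToGrlex.allMonosT (List.finRange n) d).val.length = N at *
  have hpow : (n + 1) ^ d ≤ 2 ^ d * n ^ d := by
    rw [← mul_pow]
    exact Nat.pow_le_pow_left (by omega) d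
  -- Here `d ≥ 1` is needed: the steps spent on strings of `n` bits must be absorbed into `n ^ d`.
  have hnd : n ≤ n ^ d := Nat.le_self_pow (by omega) n
  have hN' : N ≤ A * n ^ d := by
    rw [hA, mul_assoc]
    exact hN.trans (Nat.mul_le_mul_left d hpow)
  have hinit' := Nat.mul_le_mul_left D hpow
  rw [two_mul d, pow_add]
  generalize n ^ d = E at *
  have h1 : N + 1 ≤ (A + 1) * E := by linarith
  have h2 : P * (n + (N + 1) + 1) ≤ P * (A + 3) * E := by
    rw [mul_assoc]
    exact Nat.mul_le_mul_left P (by linarith)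
  have h3 := Nat.mul_le_mul h1 h2
  have h4 : (D * 2 ^ d + 4) * E ≤ (D * 2 ^ d + 4) * (E * E) :=
    Nat.mul_le_mul_left _ (Nat.le_mul_of_pos_left _ (by omega))
  nlinarith
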